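/- **Problem.** An instance of the discrete-time joint replenishment problem consists of $n \ge 1$ items, $T \ge 1$ unit-length periods forming the horizon $[0,T)$, a joint ordering cost $K_0 \ge 0$ and, for every item $i \in [n]$, an ordering cost $K_i \ge 0$ and a parameter $H_i \ge 0$ (holding one unit of item $i$ for one unit of time costs $2H_i$). Each item has a unit demand rate. A policy ${\cal P} = ({\cal P}_1,\dots,{\cal P}_n)$ chooses for each item $i$ a set $S_i \subseteq \{0,1,\dots,T-1\}$ of ordering times and order quantities $q_{i,t} \ge 0$ for $t \in S_i$. The inventory level of item $i$ at time $\tau$ is $I({\cal P}_i,\tau) = \sum_{t \in S_i,\, t \le \tau} q_{i,t} - \tau$, and ${\cal P}$ is feasible if $I({\cal P}_i,\tau) \ge 0$ for all $i \in [n]$ and $\tau \in [0,T)$. The cost of ${\cal P}$ is $$F({\cal P}) = K_0 \cdot \Big|\bigcup_{i \in [n]} S_i\Big| + \sum_{i \in [n]} \Big( K_i\,|S_i| + 2H_i \int_{[0,T)} I({\cal P}_i,\tau)\,\mathrm{d}\tau \Big).$$ (If every order lasts exactly until the next order of the same item, or until $T$, the holding cost of item $i$ equals $H_i$ times the sum of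 the squared durations between its successive orders.) **Theorem.** There is a single deterministic algorithm which, given any real $\epsilon > 0$ and any instance, computes a feasible policy $\tilde{\cal P}$ with $$F(\tilde{\cal P}) \le (1+\epsilon) \cdot F({\cal P}) \quad \text{for every feasible policy } {\cal P},$$ in $O\big(2^{\tilde O(1/\epsilon^4)} \cdot (nT)^{O(1)}\big)$ time. That is, there are absolute constants $A,B,c,d$ such that the number of elementary operations is at most $$A \cdot 2^{\,B \cdot \epsilon^{-4} \cdot \log^{c}(2+1/\epsilon)} \cdot (nT)^{d}$$ for all $\epsilon > 0$ and all instances. Time is counted on a random-access machine with unit-cost operations: memory reads and writes; addition, truncated subtraction and comparison of natural numbers; addition, subtraction, multiplication, division and comparison of real numbers; conversion of a natural number to a real one; and tests, with no rounding of reals to integers. -/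

import Mathlib

noncomputable section

namespace JRP

/-! ## The discrete-time joint replenishment problem -/

/-- An instance: `n` items, `T` unit periods forming the horizon `[0, T)`, joint ordering cost `K₀`,
and for item `i` an ordering cost `K i` and a holding cost of `2 * H i` per unit of inventory and
unit of time.  The demand rate of every item is one. -/
structure Inst where
  n : ℕ
  T : ℕ
  n_pos : 0 < n
  T_pos : 0 < T
  K₀ : ℝ
  K : Fin n → ℝ
  H : Fin n → ℝ
  K₀_nonneg : 0 ≤ K₀
  K_nonneg : ∀ i, 0 ≤ K i
  H_nonneg : ∀ i, 0 ≤ H i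

/-- A policy for one item: the integer time points in `[0, T)` at which it is ordered, and the
quantity of each order (the values of `qty` outside `orders` are irrelevant). -/
structure ItemPolicy (T : ℕ) where
  orders : Finset (Fin T)
  qty : Fin T → ℝ

namespace ItemPolicy

variable {T : ℕ}

/-- Inventory level at time `τ`: everything ordered up to and including time `τ`, minus the
cumulative demand `τ`. -/
def inventory (P : ItemPolicy T) (τ : ℝ) : ℝ :=
  (∑ t ∈ P.orders.filter (fun t : Fin T => ((t : ℕ) : ℝ) ≤ τ), P.qty t) - τ

/-- Demand is met at any time of the horizon, without lost sales or back orders. -/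
def Feasible (P : ItemPolicy T) : Prop :=
  (∀ t ∈ P.orders, 0 ≤ P.qty t) ∧ ∀ τ ∈ Set.Ico (0 : ℝ) T, 0 ≤ P.inventory τ

/-- Ordering plus holding cost of a single item with parameters `K` and `H`. -/
def cost (P : ItemPolicy T) (K H : ℝ) : ℝ :=
  K * (P.orders.card : ℝ) + 2 * H * ∫ τ in Set.Ico (0 : ℝ) T, P.inventory τ

end ItemPolicy

namespace Inst

/-- A joint replenishment policy. -/
abbrev Policy (I : Inst) : Type := Fin I.n → ItemPolicy I.T

def Feasible (I : Inst) (P : I.Policy) : Prop := ∀ i, (P i).Feasible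

/-- The time points at which at least one item is ordered. -/
def jointOrders (I : Inst) (P : I.Policy) : Finset (Fin I.T) :=
  Finset.univ.biUnion fun i => (P i).orders

/-- Total cost of a policy. -/
def cost (I : Inst) (P : I.Policy) : ℝ :=
  I.K₀ * ((I.jointOrders P).card : ℝ) + ∑ i, (P i).cost (I.K i) (I.H i)

end Inst

/-! ## A real random-access machine with unit-cost operations

The memory consists of arrays of natural numbers and arrays of real numbers.  A program is a fixed
finite text; it names arrays by constants and computes the index inside an array.  The
natural numbers can be added, subtracted and compared; the reals can be added, subtracted,
multiplied, divided and compared.  There is no conversion from reals to natural numbers (no floor),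
and the only constants are natural numbers. -/

/-- Memory contents: `nat a i` (`real a i`) is cell `i` of array `a`. -/
structure State where
  nat : ℕ → ℕ → ℕ
  real : ℕ → ℕ → ℝ

inductive NExpr where
  | lit (k : ℕ)
  | get (a : ℕ) (i : NExpr)
  | add (e f : NExpr)
  | sub (e f : NExpr)

namespace NExpr

def eval (s : State) : NExpr → ℕ
  | lit k => k
  | get a i => s.nat a (i.eval s)
  | add e f => e.eval s + f.eval s
  | sub e f => e.eval s - f.eval s

/-- Number of elementary operations of an evaluation. -/
def ops : NExpr → ℕ
  | lit _ => 1
  | get _ i => i.ops + 1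
  | add e f => e.ops + f.ops + 1
  | sub e f => e.ops + f.ops + 1

end NExpr

inductive RExpr where
  | ofNat (e : NExpr)
  | get (a : ℕ) (i : NExpr)
  | add (e f : RExpr)
  | sub (e f : RExpr)
  | mul (e f : RExpr)
  | div (e f : RExpr)

namespace RExpr

def eval (s : State) : RExpr → ℝ
  | ofNat e => (e.eval s : ℝ)
  | get a i => s.real a (i.eval s)
  | add e f => e.eval s + f.eval s
  | sub e f => e.eval s - f.eval s
  | mul e f => e.eval s * f.eval s
  | div e f => e.eval s / f.eval s

/-- Number of elementary operations of an evaluation. -/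
def ops : RExpr → ℕ
  | ofNat e => e.ops + 1
  | get _ i => i.ops + 1
  | add e f => e.ops + f.ops + 1
  | sub e f => e.ops + f.ops + 1
  | mul e f => e.ops + f.ops + 1
  | div e f => e.ops + f.ops + 1

end RExpr

/-- Tests. -/
inductive BExpr where
  | natLe (e f : NExpr)
  | realLe (e f : RExpr)
  | not (b : BExpr)
  | and (b c : BExpr)

namespace BExpr

def Holds (s : State) : BExpr → Prop
  | natLe e f => e.eval s ≤ f.eval s
  | realLe e f => e.eval s ≤ f.eval s
  | not b => ¬ b.Holds s
  | and b c => b.Holds s ∧ c.Holds s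

/-- Number of elementary operations of an evaluation. -/
def ops : BExpr → ℕ
  | natLe e f => e.ops + f.ops + 1
  | realLe e f => e.ops + f.ops + 1
  | not b => b.ops + 1
  | and b c => b.ops + c.ops + 1

end BExpr

/-- Programs. -/
inductive Prog where
  | skip
  | setNat (a : ℕ) (i : NExpr) (e : NExpr)
  | setReal (a : ℕ) (i : NExpr) (e : RExpr)
  | seq (p q : Prog)
  | ite (b : BExpr) (p q : Prog)
  | loop (b : BExpr) (p : Prog)

namespace State

def writeNat (s : State) (a i v : ℕ) : State :=
  { s with nat := Function.update s.nat a (Function.update (s.nat a) i v) }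

def writeReal (s : State) (a i : ℕ) (v : ℝ) : State :=
  { s with real := Function.update s.real a (Function.update (s.real a) i v) }

end State

/-- `Exec p s k s'`: started in memory `s`, program `p` halts after exactly `k` elementary
operations with memory `s'`.  The program `loop b p` repeats `p` as long as `b` holds. -/
inductive Exec : Prog → State → ℕ → State → Prop where
  | skip (s : State) : Exec .skip s 1 s
  | setNat (a : ℕ) (i e : NExpr) (s : State) :
      Exec (.setNat a i e) s (i.ops + e.ops + 1) (s.writeNat a (i.eval s) (e.eval s))
  | setReal (a : ℕ) (i : NExpr) (e : RExpr) (s : State) :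
      Exec (.setReal a i e) s (i.ops + e.ops + 1) (s.writeReal a (i.eval s) (e.eval s))
  | seq {p q : Prog} {s s₁ s₂ : State} {k l : ℕ} :
      Exec p s k s₁ → Exec q s₁ l s₂ → Exec (.seq p q) s (k + l) s₂
  | iteTrue {b : BExpr} {p : Prog} (q : Prog) {s s₁ : State} {k : ℕ} :
      b.Holds s → Exec p s k s₁ → Exec (.ite b p q) s (b.ops + k + 1) s₁
  | iteFalse {b : BExpr} (p : Prog) {q : Prog} {s s₁ : State} {k : ℕ} :
      ¬ b.Holds s → Exec q s k s₁ → Exec (.ite b p q) s (b.ops + k + 1) s₁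
  | loopStop {b : BExpr} (p : Prog) {s : State} :
      ¬ b.Holds s → Exec (.loop b p) s (b.ops + 1) s
  | loopStep {b : BExpr} {p : Prog} {s s₁ s₂ : State} {k l : ℕ} :
      b.Holds s → Exec p s k s₁ → Exec (.loop b p) s₁ l s₂ →
        Exec (.loop b p) s (b.ops + 1 + k + l) s₂

/-- The machine is deterministic. -/
theorem Exec.deterministic {p : Prog} {s s₁ s₂ : State} {k l : ℕ}
    (h₁ : Exec p s k s₁) (h₂ : Exec p s l s₂) : k = l ∧ s₁ = s₂ := by
  induction h₁ generalizing l s₂ with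
  | skip s => cases h₂; exact ⟨rfl, rfl⟩
  | setNat a i e s => cases h₂; exact ⟨rfl, rfl⟩
  | setReal a i e s => cases h₂; exact ⟨rfl, rfl⟩
  | seq _ _ ih₁ ih₂ =>
    cases h₂ with
    | seq g₁ g₂ =>
      obtain ⟨rfl, rfl⟩ := ih₁ g₁
      obtain ⟨rfl, rfl⟩ := ih₂ g₂
      exact ⟨rfl, rfl⟩
  | iteTrue q hb _ ih =>
    cases h₂ with
    | iteTrue _ _ g => obtain ⟨rfl, rfl⟩ := ih g; exact ⟨rfl, rfl⟩
    | iteFalse _ hb' _ => exact absurd hb hb'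
  | iteFalse p hb _ ih =>
    cases h₂ with
    | iteTrue _ hb' _ => exact absurd hb' hb
    | iteFalse _ _ g => obtain ⟨rfl, rfl⟩ := ih g; exact ⟨rfl, rfl⟩
  | loopStop p hb =>
    cases h₂ with
    | loopStop _ _ => exact ⟨rfl, rfl⟩
    | loopStep hb' _ _ => exact absurd hb' hb
  | loopStep hb _ _ ih₁ ih₂ =>
    cases h₂ with
    | loopStop _ hb' => exact absurd hb hb'
    | loopStep _ g₁ g₂ =>
      obtain ⟨rfl, rfl⟩ := ih₁ g₁
      obtain ⟨rfl, rfl⟩ := ih₂ g₂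
      exact ⟨rfl, rfl⟩

/-! ## Input and output conventions -/

/-- Initial memory on accuracy `ε` and instance `I`: the natural array `0` holds `n, T`; the real
array `0` holds `ε, K₀`; the real arrays `1` and `2` hold the item ordering costs `K` and the
parameters `H`.  All other cells are zero. -/
def input (ε : ℝ) (I : Inst) : State where
  nat a j := if a = 0 then (if j = 0 then I.n else if j = 1 then I.T else 0) else 0
  real a j :=
    if a = 0 then (if j = 0 then ε else if j = 1 then I.K₀ else 0)
    else if h : j < I.n then (if a = 1 then I.K ⟨j, h⟩ else if a = 2 then I.H ⟨j, h⟩ else 0)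
    else 0

/-- The policy found in the final memory: item `i` is ordered at time `t` iff cell `i * T + t` of
the natural array `1` is nonzero, and the quantity is cell `i * T + t` of the real array `3`. -/
def output (I : Inst) (s : State) : I.Policy := fun i =>
  { orders := Finset.univ.filter fun t : Fin I.T => s.nat 1 ((i : ℕ) * I.T + (t : ℕ)) ≠ 0
    qty := fun t => s.real 3 ((i : ℕ) * I.T + (t : ℕ)) }

end JRP

end

noncomputable section

namespace JRP

/-! ## Costs of ordering sets -/

/-! The set of joint order times is the only hard part. Once a set `S` of admissible times is fixed,
the items separate, and a shortest-path dynamic program finds the cheapest orders of each item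
inside `S`. It therefore suffices to enumerate a small family of sets `S`, one of which is nearly
optimal.

Let `F` be the cost of a feasible policy, let `N` be its number of joint orders, and let `g` satisfy
`g η² ≥ 2`. Three scales are used: a unit `d = e + 1` with `e` about `η T K₀ / (2F)`, a grid step `G
= g d`, and a window `w = g G`. Postpone every order to a multiple of `d` and add all multiples of
`G` as joint orders; the choice of `e` makes the added joint orders cost at most `η F`
(`exists_rounding_unit`). An item with `m` orders holds at least `T²/m` by Cauchy–Schwarz
(`sq_le_card_mul_sum_held`), and `2em ≤ 2eN ≤ ηT`, so postponing costs it at most a factor `1 + η`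
in holding.

An item whose mean gap `T/m` is below `G/η` can also afford an order at every multiple of `w`
(`setCost_rounded_union_le`). These orders decouple the windows, so the cheapest complete window can
be copied into all the others without loss (`exists_repeated_cost_le`). Every other item can be
ordered periodically with a period divisible by `G` (`exists_multiples_cost_le`); it uses only grid
points, which the copying preserves because `G ∣ w`.

What remains of the joint orders is described by `e ≤ T` and by two blocks of `g²` bits, one for the
repeated window and one for the incomplete end of the horizon. With `g = O(1/ε²)` there are at most
`(T + 1) · 2^(2g²)` candidates, so even the exponent `O(1/ε⁴)` without logarithmic factors suffices.
Since `F` is unknown, every `e` is tried. The rest of the proof is a verified program that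
enumerates the candidates, evaluates them by dynamic programming and outputs the best. -/

/-- The first element of `A` at or after `t`, or `T` if it comes earlier. -/
def nextOrder (A : Finset ℕ) (T t : ℕ) : ℕ :=
  (insert T (A.filter (t ≤ ·))).min' ⟨T, Finset.mem_insert_self _ _⟩

lemma nextOrder_le (A : Finset ℕ) (T t : ℕ) : nextOrder A T t ≤ T :=
  Finset.min'_le _ _ (Finset.mem_insert_self _ _)

lemma nextOrder_le_of_mem {A : Finset ℕ} {T t s : ℕ} (hs : s ∈ A) (h : t ≤ s) :
    nextOrder A T t ≤ s :=
  Finset.min'_le _ _ (by simp [hs, h])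

lemma nextOrder_eq_or_mem (A : Finset ℕ) (T t : ℕ) :
    nextOrder A T t = T ∨ (nextOrder A T t ∈ A ∧ t ≤ nextOrder A T t) := by
  have := Finset.min'_mem (insert T (A.filter (t ≤ ·))) ⟨T, Finset.mem_insert_self _ _⟩
  simpa [nextOrder] using this

lemma le_nextOrder {A : Finset ℕ} {T t : ℕ} (h : t ≤ T) : t ≤ nextOrder A T t := by
  rcases nextOrder_eq_or_mem A T t with h' | h' <;> omega

lemma nextOrder_self (A : Finset ℕ) (T : ℕ) : nextOrder A T T = T :=
  le_antisymm (nextOrder_le _ _ _) (le_nextOrder le_rfl)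

lemma nextOrder_of_mem {A : Finset ℕ} {T t : ℕ} (ht : t ∈ A) (h : t ≤ T) :
    nextOrder A T t = t :=
  le_antisymm (nextOrder_le_of_mem ht le_rfl) (le_nextOrder h)

lemma nextOrder_of_notMem {A : Finset ℕ} (T : ℕ) {t : ℕ} (ht : t ∉ A) :
    nextOrder A T t = nextOrder A T (t + 1) := by
  apply le_antisymm
  · rcases nextOrder_eq_or_mem A T (t + 1) with h' | ⟨h', h''⟩
    · rw [h']; exact nextOrder_le _ _ _
    · exact nextOrder_le_of_mem h' (by omega)
  · rcases nextOrder_eq_or_mem A T t with h' | ⟨h', h''⟩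
    · rw [h']; exact nextOrder_le _ _ _
    · refine nextOrder_le_of_mem h' ?_
      rcases h''.lt_or_eq with h3 | h3
      · exact h3
      · rw [← h3] at h'; exact absurd h' ht

lemma nextOrder_anti {A B : Finset ℕ} (h : A ⊆ B) (T t : ℕ) :
    nextOrder B T t ≤ nextOrder A T t := by
  rcases nextOrder_eq_or_mem A T t with h' | ⟨h', h''⟩
  · rw [h']; exact nextOrder_le _ _ _
  · exact nextOrder_le_of_mem (h h') h''

/-- Twice the inventory held during the period that starts at `t`. -/
def held (A : Finset ℕ) (T t : ℕ) : ℝ := 2 * ((nextOrder A T (t + 1) : ℝ) - t) - 1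

lemma held_nonneg {A : Finset ℕ} {T t : ℕ} (h : t < T) : 0 ≤ held A T t := by
  have : t + 1 ≤ nextOrder A T (t + 1) := le_nextOrder h
  have : (t : ℝ) + 1 ≤ nextOrder A T (t + 1) := by exact_mod_cast this
  unfold held; linarith

/-- The cost of an item that is ordered at the times of `A`, each order lasting until the next. -/
def setCost (K H : ℝ) (T : ℕ) (A : Finset ℕ) : ℝ :=
  K * A.card + H * ∑ t ∈ Finset.range T, held A T t

lemma setCost_nonneg {K H : ℝ} (hK : 0 ≤ K) (hH : 0 ≤ H) (T : ℕ) (A : Finset ℕ) :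
    0 ≤ setCost K H T A :=
  add_nonneg (by positivity)
    (mul_nonneg hH (Finset.sum_nonneg fun _ ht => held_nonneg (Finset.mem_range.1 ht)))

lemma setCost_eq_sum (K H : ℝ) {T : ℕ} {A : Finset ℕ} (hA : A ⊆ Finset.range T) :
    setCost K H T A =
      ∑ t ∈ Finset.range T, ((if t ∈ A then K else 0) + H * held A T t) := by
  rw [Finset.sum_add_distrib, ← Finset.mul_sum, setCost, ← Finset.sum_filter,
    Finset.filter_mem_eq_inter, Finset.inter_eq_right.2 hA, Finset.sum_const, nsmul_eq_mul,
    mul_comm K]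

lemma filter_lt_succ (A : Finset ℕ) (t : ℕ) :
    (A.filter (· < t + 1)) = if t ∈ A then insert t (A.filter (· < t)) else A.filter (· < t) := by
  ext s
  split_ifs with h
  · simp only [Finset.mem_filter, Finset.mem_insert, Nat.lt_succ_iff_lt_or_eq]
    constructor
    · tauto
    · rintro (rfl | h') <;> tauto
  · simp only [Finset.mem_filter, Nat.lt_succ_iff_lt_or_eq]
    constructor
    · rintro ⟨h1, h2 | rfl⟩ <;> tauto
    · tauto

/-- The cost of an ordering set is the sum of the costs of its gaps, here with a telescoping
potential `V`. -/
lemma setCost_add_potential (K H : ℝ) (T : ℕ) (A : Finset ℕ) (h0 : 0 ∈ A)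
    (hA : A ⊆ Finset.range T) (V : ℕ → ℝ) :
    setCost K H T A + V T - V 0 = ∑ t ∈ A, (K + H * ((nextOrder A T (t + 1) : ℝ) - t) ^ 2
      + V (nextOrder A T (t + 1)) - V t) := by
  -- The term `H * (next - t)²` is the part of the current gap not yet summed period by period.
  -- Passing from `t` to `t + 1` lowers it by exactly `H * held`, as `x² - (x - 1)² = 2x - 1`.
  have key : ∀ t ≤ T, K * (A.filter (· < t)).card + H * ∑ s ∈ Finset.range t, held A T s
      + H * ((nextOrder A T t : ℝ) - t) ^ 2 + V (nextOrder A T t) - V 0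
      = ∑ s ∈ A.filter (· < t), (K + H * ((nextOrder A T (s + 1) : ℝ) - s) ^ 2
        + V (nextOrder A T (s + 1)) - V s) := by
    intro t
    induction t with
    | zero => intro _; simp [nextOrder_of_mem h0 (Nat.zero_le T)]
    | succ t ih =>
      intro ht
      have ih := ih (by omega)
      rw [Finset.sum_range_succ, filter_lt_succ]
      split_ifs with h
      · rw [Finset.sum_insert (by simp), ← ih, Finset.card_insert_of_notMem (by simp),
          nextOrder_of_mem h (by omega)]
        simp only [held]; push_cast; ring
      · rw [← ih, nextOrder_of_notMem T h]
        simp only [held]; push_cast; ring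
  have h := key T le_rfl
  have hf : A.filter (· < T) = A :=
    Finset.filter_true_of_mem fun s hs => Finset.mem_range.1 (hA hs)
  rw [hf, nextOrder_self] at h
  rw [← h, setCost]; ring

/-- Linear programming duality for the path of orders: a potential that no gap can decrease by more
than its cost bounds the total cost from below. -/
lemma le_setCost_of_potential {K H : ℝ} {T : ℕ} {A : Finset ℕ} (h0 : 0 ∈ A)
    (hA : A ⊆ Finset.range T) (V : ℕ → ℝ)
    (h : ∀ t ∈ A, V t ≤ K + H * ((nextOrder A T (t + 1) : ℝ) - t) ^ 2
      + V (nextOrder A T (t + 1))) : V 0 ≤ setCost K H T A + V T := by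
  have e := setCost_add_potential K H T A h0 hA V
  have : 0 ≤ setCost K H T A + V T - V 0 := by
    rw [e]; exact Finset.sum_nonneg fun t ht => by linarith [h t ht]
  linarith

lemma setCost_le_of_potential {K H : ℝ} {T : ℕ} {A : Finset ℕ} (h0 : 0 ∈ A)
    (hA : A ⊆ Finset.range T) (V : ℕ → ℝ)
    (h : ∀ t ∈ A, K + H * ((nextOrder A T (t + 1) : ℝ) - t) ^ 2
      + V (nextOrder A T (t + 1)) ≤ V t) : setCost K H T A + V T ≤ V 0 := by
  have e := setCost_add_potential K H T A h0 hA V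
  have : setCost K H T A + V T - V 0 ≤ 0 := by
    rw [e]; exact Finset.sum_nonpos fun t ht => by linarith [h t ht]
  linarith

/-- Cauchy–Schwarz for the gap lengths, which add up to `T`. With `a = T / |A|` each gap `x`
satisfies `a² + x² ≥ 2ax`, and the linear potential of slope `2a` adds these inequalities up. -/
lemma sq_le_card_mul_sum_held {T : ℕ} {A : Finset ℕ} (h0 : 0 ∈ A) (hA : A ⊆ Finset.range T) :
    (T : ℝ) ^ 2 ≤ A.card * ∑ t ∈ Finset.range T, held A T t := by
  have hc : (0 : ℝ) < A.card := by exact_mod_cast Finset.card_pos.2 ⟨0, h0⟩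
  have h := le_setCost_of_potential (K := ((T : ℝ) / A.card) ^ 2) (H := 1) h0 hA
    (fun t => 2 * ((T : ℝ) / A.card) * ((T : ℝ) - t)) (fun t _ => by
      nlinarith [sq_nonneg ((T : ℝ) / A.card - ((nextOrder A T (t + 1) : ℝ) - t))])
  simp only [setCost] at h
  have e : ((T : ℝ) / A.card) ^ 2 * A.card = (T : ℝ) ^ 2 / A.card := by field_simp
  have e2 : 2 * ((T : ℝ) / A.card) * ((T : ℝ) - (0 : ℕ)) = 2 * ((T : ℝ) ^ 2 / A.card) := by
    push_cast; field_simp; ring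
  rw [e, e2] at h
  have h3 : (T : ℝ) ^ 2 / A.card ≤ ∑ t ∈ Finset.range T, held A T t := by linarith
  rw [div_le_iff₀ hc] at h3; linarith

/-! ## Multiples -/

/-- The multiples of `r` below `T`. -/
def multiples (T r : ℕ) : Finset ℕ := (Finset.range T).filter (r ∣ ·)

lemma mem_multiples {T r t : ℕ} : t ∈ multiples T r ↔ t < T ∧ r ∣ t := by simp [multiples]

lemma card_multiples_erase_zero_le (T r : ℕ) :
    ((multiples T r).erase 0).card ≤ (T - 1) / r := by
  rw [← Nat.card_multiples (T - 1) r]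
  refine le_trans (Finset.card_le_card (t := ((Finset.range (T - 1)).filter
    (fun k => r ∣ k + 1)).image (· + 1)) ?_) Finset.card_image_le
  intro t ht
  simp only [Finset.mem_erase, mem_multiples] at ht
  simp only [Finset.mem_image, Finset.mem_filter, Finset.mem_range]
  refine ⟨t - 1, ⟨by omega, ?_⟩, by omega⟩
  rw [Nat.sub_add_cancel (by omega)]; exact ht.2.2

lemma card_multiples_mul_le {T : ℕ} (hT : 0 < T) (r : ℕ) :
    (multiples T r).card * r ≤ T - 1 + r := by
  have h0 : 0 ∈ multiples T r := mem_multiples.2 ⟨hT, dvd_zero _⟩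
  have h1 := card_multiples_erase_zero_le T r
  rw [Finset.card_erase_of_mem h0] at h1
  have h2 : (multiples T r).card ≤ (T - 1) / r + 1 := by omega
  have h3 := Nat.div_mul_le_self (T - 1) r
  have h4 : (multiples T r).card * r ≤ ((T - 1) / r + 1) * r := Nat.mul_le_mul_right _ h2
  rw [add_mul] at h4; omega

/-- Each gap `x` is at most `r`, hence `x² ≤ r x`, and the gaps add up to `T`. -/
lemma sum_held_multiples_le {T : ℕ} (hT : 0 < T) {r : ℕ} (hr : 0 < r) :
    ∑ t ∈ Finset.range T, held (multiples T r) T t ≤ r * T := by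
  have h0 : 0 ∈ multiples T r := mem_multiples.2 ⟨hT, dvd_zero _⟩
  have h := setCost_le_of_potential (K := 0) (H := 1) h0 (Finset.filter_subset _ _)
    (fun t => (r : ℝ) * ((T : ℝ) - t)) (fun t ht => by
      rw [mem_multiples] at ht
      have h1 : t + 1 ≤ nextOrder (multiples T r) T (t + 1) := le_nextOrder ht.1
      have h2 : nextOrder (multiples T r) T (t + 1) ≤ t + r := by
        rcases lt_or_ge (t + r) T with h' | h'
        · exact nextOrder_le_of_mem (mem_multiples.2 ⟨h', ht.2.add (dvd_refl r)⟩) (by omega)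
        · exact (nextOrder_le _ _ _).trans h'
      have h1' : (t : ℝ) + 1 ≤ nextOrder (multiples T r) T (t + 1) := by exact_mod_cast h1
      have h2' : (nextOrder (multiples T r) T (t + 1) : ℝ) ≤ t + r := by exact_mod_cast h2
      nlinarith)
  simpa [setCost] using h

/-! ## Rounding, adding and repeating orders -/

/-- The smallest multiple of `d` that is at least `t`. -/
def roundUp (d t : ℕ) : ℕ := (t + (d - 1)) / d * d

lemma le_roundUp {d : ℕ} (hd : 0 < d) (t : ℕ) : t ≤ roundUp d t := by
  have := Nat.div_add_mod (t + (d - 1)) d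
  have := Nat.mod_lt (t + (d - 1)) hd
  have := mul_comm d ((t + (d - 1)) / d)
  unfold roundUp; omega

lemma roundUp_le (d t : ℕ) : roundUp d t ≤ t + (d - 1) := Nat.div_mul_le_self _ _

lemma dvd_roundUp (d t : ℕ) : d ∣ roundUp d t := Dvd.intro_left _ rfl

lemma roundUp_zero {d : ℕ} (hd : 0 < d) : roundUp d 0 = 0 := by
  unfold roundUp; rw [Nat.div_eq_of_lt (by omega), zero_mul]

/-- All orders of `A` postponed to multiples of `d`. -/
def roundedOrders (T d : ℕ) (A : Finset ℕ) : Finset ℕ :=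
  (A.image (roundUp d)).filter (· < T)

lemma roundedOrders_subset (T d : ℕ) (A : Finset ℕ) : roundedOrders T d A ⊆ Finset.range T :=
  fun _ ht => Finset.mem_range.2 (Finset.mem_filter.1 ht).2

lemma roundedOrders_mono (T d : ℕ) {A B : Finset ℕ} (h : A ⊆ B) :
    roundedOrders T d A ⊆ roundedOrders T d B :=
  Finset.filter_subset_filter _ (Finset.image_subset_image h)

lemma card_roundedOrders_le (T d : ℕ) (A : Finset ℕ) : (roundedOrders T d A).card ≤ A.card :=
  (Finset.card_filter_le _ _).trans Finset.card_image_le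

lemma dvd_of_mem_roundedOrders {T d t : ℕ} {A : Finset ℕ} (h : t ∈ roundedOrders T d A) :
    d ∣ t := by
  simp only [roundedOrders, Finset.mem_filter, Finset.mem_image] at h
  obtain ⟨⟨s, -, rfl⟩, -⟩ := h
  exact dvd_roundUp d s

lemma zero_mem_roundedOrders {T d : ℕ} {A : Finset ℕ} (hT : 0 < T) (hd : 0 < d) (h : 0 ∈ A) :
    0 ∈ roundedOrders T d A := by
  simp only [roundedOrders, Finset.mem_filter, Finset.mem_image]
  exact ⟨⟨0, h, roundUp_zero hd⟩, hT⟩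

/-- An order rounded beyond the horizon disappears, which is harmless because `nextOrder` never
exceeds `T`. -/
lemma nextOrder_roundedOrders_le {d : ℕ} (hd : 0 < d) (A : Finset ℕ) (T t : ℕ) :
    nextOrder (roundedOrders T d A) T t ≤ nextOrder A T t + (d - 1) := by
  rcases nextOrder_eq_or_mem A T t with h | ⟨h, h'⟩
  · rw [h]; exact (nextOrder_le _ _ _).trans (Nat.le_add_right _ _)
  · refine le_trans ?_ (roundUp_le d _)
    have h1 := le_roundUp hd (nextOrder A T t)
    rcases lt_or_ge (roundUp d (nextOrder A T t)) T with h2 | h2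
    · refine nextOrder_le_of_mem ?_ (h'.trans h1)
      simp only [roundedOrders, Finset.mem_filter, Finset.mem_image]
      exact ⟨⟨_, h, rfl⟩, h2⟩
    · exact (nextOrder_le _ _ _).trans h2

lemma held_roundedOrders_le {d : ℕ} (hd : 0 < d) (A : Finset ℕ) (T t : ℕ) :
    held (roundedOrders T d A) T t ≤ held A T t + 2 * ((d : ℝ) - 1) := by
  have h := nextOrder_roundedOrders_le hd A T (t + 1)
  have h' : (nextOrder (roundedOrders T d A) T (t + 1) : ℝ) ≤
      nextOrder A T (t + 1) + ((d : ℝ) - 1) := by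
    have : nextOrder (roundedOrders T d A) T (t + 1) + 1 ≤ nextOrder A T (t + 1) + d := by omega
    have : (nextOrder (roundedOrders T d A) T (t + 1) : ℝ) + 1 ≤ nextOrder A T (t + 1) + d := by
      exact_mod_cast this
    linarith
  unfold held; linarith

lemma held_anti {A B : Finset ℕ} (h : A ⊆ B) (T t : ℕ) : held B T t ≤ held A T t := by
  have : (nextOrder B T (t + 1) : ℝ) ≤ nextOrder A T (t + 1) := by
    exact_mod_cast nextOrder_anti h T (t + 1)
  unfold held; linarith

/-- The multiple `0` is already in `A`, so only positive multiples are new. This saves the additive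
one that would spoil a purely relative error bound. -/
lemma card_union_multiples_le {A : Finset ℕ} (h0 : 0 ∈ A) (T r : ℕ) :
    (A ∪ multiples T r).card ≤ A.card + T / r := by
  have : A ∪ multiples T r = A ∪ (multiples T r).erase 0 := by
    ext t
    by_cases ht : t = 0
    · subst ht; simp [h0]
    · simp [ht]
  rw [this]
  exact (Finset.card_union_le _ _).trans (Nat.add_le_add_left
    ((card_multiples_erase_zero_le T r).trans (Nat.div_le_div_right (Nat.sub_le T 1))) _)

/-! ### Repetition of one window -/

/-- The period that serves as a model for the period `t` when window `j` is repeated in all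
complete windows of length `w`. -/
def source (T w j t : ℕ) : ℕ := if t < T / w * w then j * w + t % w else t

/-- The orders of window `j` repeated in all complete windows of length `w`. -/
def repeated (T w j : ℕ) (A : Finset ℕ) : Finset ℕ :=
  (Finset.range T).filter (fun t => source T w j t ∈ A)

lemma mem_repeated {T w j t : ℕ} {A : Finset ℕ} :
    t ∈ repeated T w j A ↔ t < T ∧ source T w j t ∈ A := by simp [repeated]

lemma window_source {w k j : ℕ} (a b : ℕ) (hb : b < w) (ha : a < k) :
    a * w + b < k * w ∧ j * w + (a * w + b) % w = j * w + b := by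
  constructor
  · have : (a + 1) * w ≤ k * w := Nat.mul_le_mul_right _ ha
    rw [add_mul] at this; omega
  · rw [add_comm (a * w), Nat.add_mul_mod_self_right, Nat.mod_eq_of_lt hb]

/-- Orders at all multiples of `w` prevent inventory from crossing the end of a window. The waiting
time until the next order is thus determined inside the window and is copied with it. -/
lemma held_repeated_le {T w j : ℕ} {A : Finset ℕ} (hw : 0 < w)
    (hA : multiples T w ⊆ A) (hj : j < T / w ∨ T / w = 0) (t : ℕ) :
    held (repeated T w j A) T t ≤ held A T (source T w j t) := by
  obtain ⟨k, hk⟩ : ∃ k, k = T / w := ⟨_, rfl⟩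
  have hkT : k * w ≤ T := hk ▸ Nat.div_mul_le_self T w
  have hmem : ∀ a, a * w < T → a * w ∈ A := fun a h =>
    hA (mem_multiples.2 ⟨h, Dvd.intro_left _ rfl⟩)
  have h : nextOrder (repeated T w j A) T (t + 1) + source T w j t ≤
      nextOrder A T (source T w j t + 1) + t := by
    obtain ⟨c, hc⟩ : ∃ c, c = nextOrder A T (source T w j t + 1) := ⟨_, rfl⟩
    rw [← hc]
    by_cases htk : t < k * w
    · have hs : source T w j t = j * w + t % w := by rw [source, ← hk, if_pos htk]
      have hjk : j < k := by
        rcases hj with h | h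
        · omega
        · rw [hk, h] at htk; omega
      set a := t / w with ha
      set b := t % w with hb'
      have hab : a * w + b = t := by rw [mul_comm]; exact Nat.div_add_mod t w
      have hb : b < w := Nat.mod_lt _ hw
      have hak : a < k := by
        by_contra h
        have := Nat.mul_le_mul_right w (not_lt.1 h)
        omega
      have hj1 : (j + 1) * w ≤ k * w := Nat.mul_le_mul_right _ hjk
      have ha1 : (a + 1) * w ≤ k * w := Nat.mul_le_mul_right _ hak
      have hj1' : (j + 1) * w = j * w + w := by ring
      have ha1' : (a + 1) * w = a * w + w := by ring
      have hcle : c ≤ (j + 1) * w := by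
        rcases lt_or_ge ((j + 1) * w) T with h | h
        · rw [hc]; exact nextOrder_le_of_mem (hmem _ h) (by omega)
        · rw [hc]; exact (nextOrder_le _ _ _).trans h
      have hcge : source T w j t + 1 ≤ c := by rw [hc]; exact le_nextOrder (by omega)
      -- Either the next order lies inside window `j` and has a copy at the same offset, or it is
      -- the end of the window, where the repeated set also has an order unless the horizon is over.
      rcases hcle.lt_or_eq with hlt | heq
      · have hcA : c ∈ A := by
          rcases nextOrder_eq_or_mem A T (source T w j t + 1) with h | ⟨h, -⟩
          · omega
          · rw [hc]; exact h
        have hw' := window_source (j := j) (w := w) a (c - j * w) (by omega) hak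
        have : nextOrder (repeated T w j A) T (t + 1) ≤ a * w + (c - j * w) := by
          refine nextOrder_le_of_mem (mem_repeated.2 ⟨by omega, ?_⟩) (by omega)
          rw [source, ← hk, if_pos hw'.1, hw'.2, Nat.add_sub_cancel' (by omega)]
          exact hcA
        omega
      · have : nextOrder (repeated T w j A) T (t + 1) ≤ (a + 1) * w := by
          rcases lt_or_ge ((a + 1) * w) T with h | h
          · refine nextOrder_le_of_mem (mem_repeated.2 ⟨h, ?_⟩) (by omega)
            rw [source, ← hk]
            split_ifs with h'
            · rw [Nat.mul_mod_left, add_zero]; exact hmem _ (by omega)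
            · exact hmem _ h
          · exact (nextOrder_le _ _ _).trans h
        omega
    · have hs : source T w j t = t := by rw [source, ← hk, if_neg htk]
      rw [hs] at hc ⊢
      have : nextOrder (repeated T w j A) T (t + 1) ≤ c := by
        rcases nextOrder_eq_or_mem A T (t + 1) with h | ⟨h, h'⟩
        · rw [hc, h]; exact nextOrder_le _ _ _
        · rcases lt_or_ge c T with h2 | h2
          · refine nextOrder_le_of_mem (mem_repeated.2 ⟨h2, ?_⟩) (by omega)
            rw [source, ← hk, if_neg (by omega), hc]; exact h
          · exact (nextOrder_le _ _ _).trans h2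
      omega
  have h' : (nextOrder (repeated T w j A) T (t + 1) : ℝ) + source T w j t ≤
      nextOrder A T (source T w j t + 1) + t := by exact_mod_cast h
  unfold held; linarith

/-- Some window is no more expensive than the average window. -/
lemma exists_cheap_window (T w : ℕ) (D : ℕ → ℝ) :
    ∃ j, (j < T / w ∨ T / w = 0) ∧
      ∑ t ∈ Finset.range T, D (source T w j t) ≤ ∑ t ∈ Finset.range T, D t := by
  obtain ⟨k, hk⟩ : ∃ k, k = T / w := ⟨_, rfl⟩
  have hkT : k * w ≤ T := hk ▸ Nat.div_mul_le_self T w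
  rw [← hk]
  have split : ∀ f : ℕ → ℝ, ∑ t ∈ Finset.range T, f t =
      ∑ a ∈ Finset.range k, ∑ b ∈ Finset.range w, f (a * w + b)
        + ∑ b ∈ Finset.range (T - k * w), f (k * w + b) := by
    intro f
    have h1 : ∀ k, ∑ t ∈ Finset.range (k * w), f t =
        ∑ a ∈ Finset.range k, ∑ b ∈ Finset.range w, f (a * w + b) := by
      intro k
      induction k with
      | zero => simp
      | succ k ih => rw [add_mul, one_mul, Finset.sum_range_add, ih, Finset.sum_range_succ]
    rw [← h1, ← Finset.sum_range_add, Nat.add_sub_cancel' hkT]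
  rcases Nat.eq_zero_or_pos k with h0 | hpos
  · refine ⟨0, Or.inr h0, le_of_eq (Finset.sum_congr rfl fun t _ => ?_)⟩
    rw [source, ← hk, h0, zero_mul, if_neg (Nat.not_lt_zero t)]
  · obtain ⟨j, hj, hmin⟩ := Finset.exists_min_image (Finset.range k)
      (fun a => ∑ b ∈ Finset.range w, D (a * w + b)) ⟨0, Finset.mem_range.2 hpos⟩
    refine ⟨j, Or.inl (Finset.mem_range.1 hj), ?_⟩
    rw [split, split D]
    refine add_le_add (Finset.sum_le_sum fun a ha => ?_) (le_of_eq (Finset.sum_congr rfl ?_))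
    · refine le_trans (le_of_eq (Finset.sum_congr rfl fun b hb => ?_)) (hmin a ha)
      have h := window_source (j := j) a b (Finset.mem_range.1 hb) (Finset.mem_range.1 ha)
      rw [source, ← hk, if_pos h.1, h.2]
    · intro b _
      rw [source, ← hk, if_neg (by omega)]

/-! ## Feasible policies and ordering sets -/

namespace ItemPolicy

variable {T : ℕ}

/-- The total quantity ordered up to time `t`. -/
def ordered (P : ItemPolicy T) (t : ℕ) : ℝ :=
  ∑ s ∈ P.orders.filter (fun s : Fin T => (s : ℕ) ≤ t), P.qty s

/-- The ordering times as natural numbers. -/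
def times (P : ItemPolicy T) : Finset ℕ := P.orders.map Fin.valEmbedding

lemma mem_times {P : ItemPolicy T} {t : ℕ} : t ∈ P.times ↔ ∃ s ∈ P.orders, (s : ℕ) = t := by
  simp [times]

lemma card_times (P : ItemPolicy T) : P.times.card = P.orders.card := Finset.card_map _

lemma times_subset (P : ItemPolicy T) : P.times ⊆ Finset.range T := by
  intro t ht
  obtain ⟨s, -, rfl⟩ := mem_times.1 ht
  exact Finset.mem_range.2 s.2

lemma inventory_eq (P : ItemPolicy T) {t : ℕ} {τ : ℝ} (h : (t : ℝ) ≤ τ) (h' : τ < t + 1) :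
    P.inventory τ = P.ordered t - τ := by
  unfold inventory ordered
  congr 2
  ext s
  simp only [Finset.mem_filter, and_congr_right_iff]
  intro _
  constructor
  · intro hs
    have : ((s : ℕ) : ℝ) < t + 1 := hs.trans_lt h'
    have : (s : ℕ) < t + 1 := by exact_mod_cast this
    omega
  · intro hs
    have : ((s : ℕ) : ℝ) ≤ t := by exact_mod_cast hs
    linarith

/-- On each unit period the inventory is affine with slope `-1`, starting from `ordered t - t`. -/
lemma setIntegral_inventory (P : ItemPolicy T) :
    2 * ∫ τ in Set.Ico (0 : ℝ) T, P.inventory τ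
      = ∑ t ∈ Finset.range T, (2 * (P.ordered t - t) - 1) := by
  have key : ∀ t : ℕ, Set.EqOn P.inventory (fun τ => P.ordered t - τ) (Set.Ico (t : ℝ) (t + 1)) :=
    fun t τ hτ => P.inventory_eq hτ.1 hτ.2
  have hinteg : ∀ t : ℕ, MeasureTheory.IntegrableOn P.inventory (Set.Ico (t : ℝ) (t + 1)) := by
    intro t
    rw [MeasureTheory.integrableOn_congr_fun (key t) measurableSet_Ico]
    exact ((by fun_prop : Continuous fun τ : ℝ => P.ordered t - τ).integrableOn_Icc).mono_set
      Set.Ico_subset_Icc_self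
  have hval : ∀ t : ℕ, ∫ τ in Set.Ico (t : ℝ) (t + 1), P.inventory τ = P.ordered t - t - 1 / 2 := by
    intro t
    rw [MeasureTheory.setIntegral_congr_fun measurableSet_Ico (key t),
      MeasureTheory.integral_Ico_eq_integral_Ioc,
      ← intervalIntegral.integral_of_le (by linarith), intervalIntegral.integral_sub
        (by simp) (by simp)]
    simp; ring
  have main : ∀ N : ℕ, MeasureTheory.IntegrableOn P.inventory (Set.Ico (0 : ℝ) N) ∧
      2 * ∫ τ in Set.Ico (0 : ℝ) N, P.inventory τ
        = ∑ t ∈ Finset.range N, (2 * (P.ordered t - t) - 1) := by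
    intro N
    induction N with
    | zero => simp
    | succ N ih =>
      have hU : Set.Ico (0 : ℝ) ((N + 1 : ℕ) : ℝ) =
          Set.Ico (0 : ℝ) N ∪ Set.Ico (N : ℝ) (N + 1) := by
        push_cast
        rw [Set.Ico_union_Ico_eq_Ico (by positivity) (by linarith)]
      rw [hU]
      refine ⟨ih.1.union (hinteg N), ?_⟩
      rw [MeasureTheory.setIntegral_union Set.Ico_disjoint_Ico_same measurableSet_Ico ih.1 (hinteg N),
        Finset.sum_range_succ, ← ih.2, hval]
      ring
  exact (main T).2

lemma cost_eq (P : ItemPolicy T) (K H : ℝ) :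
    P.cost K H = K * P.times.card
      + H * ∑ t ∈ Finset.range T, (2 * (P.ordered t - t) - 1) := by
  rw [cost, card_times, ← setIntegral_inventory]; ring

lemma ordered_eq_of_gap (P : ItemPolicy T) {t u : ℕ} (htu : t ≤ u)
    (h : u < nextOrder P.times T (t + 1)) : P.ordered u = P.ordered t := by
  unfold ordered
  congr 1
  ext s
  simp only [Finset.mem_filter, and_congr_right_iff]
  intro hs
  constructor
  · intro hsu
    by_contra hst
    have := nextOrder_le_of_mem (T := T) (mem_times.2 ⟨s, hs, rfl⟩) (show t + 1 ≤ s by omega)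
    omega
  · omega

/-- No order arrives between `t` and the next order time, so the quantity ordered by `t` must cover
the demand up to every earlier `τ`; the bound at the order time itself is the limit. -/
lemma Feasible.nextOrder_le_ordered {P : ItemPolicy T} (hP : P.Feasible) {t : ℕ} (ht : t < T) :
    (nextOrder P.times T (t + 1) : ℝ) ≤ P.ordered t := by
  obtain ⟨c, hc⟩ : ∃ c, c = nextOrder P.times T (t + 1) := ⟨_, rfl⟩
  have h1 : t + 1 ≤ c := hc ▸ le_nextOrder ht
  have h2 : c ≤ T := hc ▸ nextOrder_le _ _ _
  obtain ⟨u, rfl⟩ : ∃ u, c = u + 1 := ⟨c - 1, by omega⟩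
  rw [← hc]
  have h2' : (u : ℝ) + 1 ≤ T := by exact_mod_cast h2
  push_cast
  refine le_of_forall_lt_imp_le_of_dense fun τ hτ => ?_
  -- The maximum with `u` moves `τ` into the last unit period before the next order, where the
  -- ordered quantity is known.
  have hu := hP.2 (max τ u) ⟨le_max_of_le_right (by positivity), by
    rw [max_lt_iff]; constructor <;> linarith⟩
  rw [P.inventory_eq (le_max_right _ _) (max_lt hτ (by linarith)),
    P.ordered_eq_of_gap (show t ≤ u by omega) (by omega)] at hu
  linarith [le_max_left τ (u : ℝ)]

lemma Feasible.zero_mem_times {P : ItemPolicy T} (hP : P.Feasible) (hT : 0 < T) :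
    0 ∈ P.times := by
  by_contra h
  have h1 := hP.nextOrder_le_ordered hT
  have h2 : P.ordered 0 = 0 := by
    refine Finset.sum_eq_zero fun s hs => ?_
    simp only [Finset.mem_filter] at hs
    exact absurd (mem_times.2 ⟨s, hs.1, by omega⟩) h
  have h3 : (1 : ℝ) ≤ nextOrder P.times T (0 + 1) := by
    exact_mod_cast le_nextOrder (A := P.times) (show 0 + 1 ≤ T from hT)
  linarith

lemma Feasible.setCost_le_cost {P : ItemPolicy T} (hP : P.Feasible) (K : ℝ) {H : ℝ} (hH : 0 ≤ H) :
    setCost K H T P.times ≤ P.cost K H := by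
  rw [cost_eq, setCost]
  refine add_le_add le_rfl (mul_le_mul_of_nonneg_left (Finset.sum_le_sum fun t ht => ?_) hH)
  have := hP.nextOrder_le_ordered (Finset.mem_range.1 ht)
  unfold held; linarith

end ItemPolicy

/-! ## Optimal policies for a given set of joint orders -/

/-- The possible costs of an item whose orders are among those in `S`. -/
def itemCosts (K H : ℝ) (T : ℕ) (S : Finset ℕ) : Set ℝ :=
  {c | ∃ A ⊆ S, 0 ∈ A ∧ c = setCost K H T A}

namespace Inst

/-- The least cost of a policy that pays for all joint orders in `S` and uses no others. -/
def jointValue (I : Inst) (S : Finset ℕ) : ℝ :=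
  I.K₀ * S.card + ∑ i, sInf (itemCosts (I.K i) (I.H i) I.T S)

lemma jointValue_le (I : Inst) {S : Finset ℕ} {A : Fin I.n → Finset ℕ} (hA : ∀ i, A i ⊆ S)
    (h0 : ∀ i, 0 ∈ A i) :
    I.jointValue S ≤ I.K₀ * S.card + ∑ i, setCost (I.K i) (I.H i) I.T (A i) := by
  refine add_le_add le_rfl (Finset.sum_le_sum fun i _ => csInf_le ⟨0, ?_⟩ ⟨A i, hA i, h0 i, rfl⟩)
  rintro _ ⟨B, -, -, rfl⟩
  exact setCost_nonneg (I.K_nonneg i) (I.H_nonneg i) _ _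

/-- The joint ordering times as natural numbers. -/
def jointTimes (I : Inst) (P : I.Policy) : Finset ℕ := (I.jointOrders P).map Fin.valEmbedding

lemma card_jointTimes (I : Inst) (P : I.Policy) :
    (I.jointTimes P).card = (I.jointOrders P).card := Finset.card_map _

lemma mem_jointTimes {I : Inst} {P : I.Policy} {t : ℕ} :
    t ∈ I.jointTimes P ↔ ∃ i, t ∈ (P i).times := by
  simp only [jointTimes, jointOrders, Finset.mem_map, Finset.mem_biUnion, Finset.mem_univ,
    true_and, ItemPolicy.mem_times, Fin.valEmbedding_apply]
  constructor
  · rintro ⟨s, ⟨i, hi⟩, h⟩; exact ⟨i, s, hi, h⟩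
  · rintro ⟨i, s, hi, h⟩; exact ⟨s, ⟨i, hi⟩, h⟩

lemma times_subset_jointTimes {I : Inst} (P : I.Policy) (i : Fin I.n) :
    (P i).times ⊆ I.jointTimes P := fun _ ht => mem_jointTimes.2 ⟨i, ht⟩

end Inst

/-! ## The family of candidates -/

/-- Position of the period `t` in a pattern of two windows of length `w`: the first one is used
for all complete windows, the second one for the rest of the horizon. -/
def patternPos (T w t : ℕ) : ℕ := if t < T / w * w then t % w else t - T / w * w + w

/-- The joint orders described by the bits of `x`, each of which stands for `d` periods. -/
def candidate (T W d x : ℕ) : Finset ℕ :=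
  (Finset.range T).filter fun t =>
    t = 0 ∨ (d ∣ patternPos T (W * d) t ∧ x.testBit (patternPos T (W * d) t / d))

lemma candidate_subset (T W d x : ℕ) : candidate T W d x ⊆ Finset.range T :=
  Finset.filter_subset _ _

lemma zero_mem_candidate {T : ℕ} (hT : 0 < T) (W d x : ℕ) : 0 ∈ candidate T W d x := by
  simp [candidate, hT]

lemma exists_testBit (f : ℕ → Prop) (M : ℕ) :
    ∃ x < 2 ^ M, ∀ u < M, (x.testBit u = true ↔ f u) := by
  classical
  refine ⟨Nat.ofBits fun u : Fin M => decide (f u), Nat.ofBits_lt_two_pow _, fun u hu => ?_⟩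
  rw [Nat.testBit_ofBits_lt _ _ hu]; simp

/-- All orders of `U` lie on multiples of `d`, so one bit per unit is enough. Bits below `W` encode
window `j`; the others encode the part of the horizon after the last complete window, which is
shorter than one window. -/
lemma exists_candidate_eq_repeated {T W d j : ℕ} {U : Finset ℕ} (hT : 0 < T) (hd : 0 < d)
    (hW : 0 < W) (hU : ∀ t ∈ U, d ∣ t) (hmul : multiples T (W * d) ⊆ U)
    (hj : j < T / (W * d) ∨ T / (W * d) = 0) :
    ∃ x < 2 ^ (W + W), candidate T W d x = repeated T (W * d) j U := by
  obtain ⟨w, hw⟩ : ∃ w, w = W * d := ⟨_, rfl⟩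
  have hwpos : 0 < w := hw ▸ Nat.mul_pos hW hd
  have hdw : d ∣ w := hw ▸ Dvd.intro_left _ rfl
  obtain ⟨k, hk⟩ : ∃ k, k = T / w := ⟨_, rfl⟩
  have hkT : k * w ≤ T := hk ▸ Nat.div_mul_le_self T w
  have hTk : T < k * w + w := by
    have := Nat.lt_div_mul_add (a := T) hwpos
    rwa [← hk] at this
  obtain ⟨x, hx, hbit⟩ := exists_testBit (fun u =>
    if u < W then j * w + u * d ∈ U else k * w + (u * d - w) ∈ U) (W + W)
  refine ⟨x, hx, ?_⟩
  rw [← hw] at hmul hj ⊢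
  rw [← hk] at hj
  ext t
  simp only [candidate, Finset.mem_filter, Finset.mem_range, mem_repeated, and_congr_right_iff,
    ← hw]
  intro ht
  -- A candidate always contains `0`; this agrees with the repeated set, since the source of `0` is
  -- a multiple of the window length.
  have hzero : t = 0 → source T w j t ∈ U := by
    rintro rfl
    rw [source, ← hk]
    split_ifs with h
    · rw [Nat.zero_mod, add_zero]
      refine hmul (mem_multiples.2 ⟨?_, Dvd.intro_left _ rfl⟩)
      rcases hj with h' | h'
      · have := Nat.mul_le_mul_right w (show j + 1 ≤ k from h')
        rw [add_mul] at this; omega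
      · simp [h'] at h
    · exact hmul (mem_multiples.2 ⟨hT, dvd_zero _⟩)
  have hp2 : patternPos T w t < w + w := by
    rw [patternPos, ← hk]
    split_ifs
    · have := Nat.mod_lt t hwpos; omega
    · omega
  have hsrc : source T w j t = if patternPos T w t < w then j * w + patternPos T w t
      else k * w + (patternPos T w t - w) := by
    rw [source, patternPos, ← hk]
    by_cases h : t < k * w
    · rw [if_pos h, if_pos h, if_pos (Nat.mod_lt _ hwpos)]
    · rw [if_neg h, if_neg h, if_neg (by omega)]; omega
  have hiff : d ∣ patternPos T w t ∧ x.testBit (patternPos T w t / d) = true ↔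
      source T w j t ∈ U := by
    rw [hsrc]
    constructor
    · rintro ⟨⟨u, hu⟩, h⟩
      rw [hu, Nat.mul_div_cancel_left _ hd] at h
      rw [hu] at hp2 ⊢
      have hu2 : u < W + W := by
        have : d * u < d * (W + W) := by rw [mul_add, mul_comm d W, ← hw]; exact hp2
        exact lt_of_mul_lt_mul_left this (Nat.zero_le _)
      rw [hbit u hu2] at h
      have hiff : d * u < w ↔ u < W := by
        rw [hw, mul_comm d u]; exact Nat.mul_lt_mul_right hd
      by_cases h' : u < W
      · rw [if_pos (hiff.2 h')]; rwa [if_pos h', mul_comm u] at h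
      · rw [if_neg (fun h2 => h' (hiff.1 h2))]; rwa [if_neg h', mul_comm u] at h
    · intro h
      have hdp : d ∣ patternPos T w t := by
        split_ifs at h with h'
        · exact (Nat.dvd_add_right (hdw.mul_left j)).1 (hU _ h)
        · have := (Nat.dvd_add_right (hdw.mul_left k)).1 (hU _ h)
          have := this.add hdw
          rwa [Nat.sub_add_cancel (not_lt.1 h')] at this
      refine ⟨hdp, ?_⟩
      obtain ⟨u, hu⟩ := hdp
      rw [hu, Nat.mul_div_cancel_left _ hd]
      rw [hu] at hp2 h
      have hu2 : u < W + W := by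
        have : d * u < d * (W + W) := by rw [mul_add, mul_comm d W, ← hw]; exact hp2
        exact lt_of_mul_lt_mul_left this (Nat.zero_le _)
      rw [hbit u hu2]
      have hiff : d * u < w ↔ u < W := by
        rw [hw, mul_comm d u]; exact Nat.mul_lt_mul_right hd
      by_cases h' : u < W
      · rw [if_pos h']; rwa [if_pos (hiff.2 h'), mul_comm d] at h
      · rw [if_neg h']; rwa [if_neg (fun h2 => h' (hiff.1 h2)), mul_comm d] at h
  rw [hiff]
  exact ⟨fun h => h.elim hzero id, Or.inr⟩

/-! ## Some candidate is nearly optimal -/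

lemma source_lt {T w j t : ℕ} (hj : j < T / w ∨ T / w = 0) (ht : t < T) :
    source T w j t < T := by
  rw [source]
  split_ifs with h
  · have hw : 0 < w := Nat.pos_of_ne_zero fun h0 => by simp [h0] at h
    rcases hj with h' | h'
    · have h1 := Nat.mul_le_mul_right w (show j + 1 ≤ T / w from h')
      have h2 := Nat.div_mul_le_self T w
      have h3 := Nat.mod_lt t hw
      rw [add_mul] at h1; omega
    · simp [h'] at h
  · exact ht

lemma dvd_source {T w j t r : ℕ} (hr : r ∣ w) (ht : r ∣ t) : r ∣ source T w j t := by
  rw [source]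
  split_ifs
  · exact (hr.mul_left j).add ((Nat.dvd_mod_iff hr).2 ht)
  · exact ht

lemma repeated_subset (T w j : ℕ) (A : Finset ℕ) : repeated T w j A ⊆ Finset.range T :=
  Finset.filter_subset _ _

lemma repeated_mono (T w j : ℕ) {A B : Finset ℕ} (h : A ⊆ B) :
    repeated T w j A ⊆ repeated T w j B := fun _ ht =>
  mem_repeated.2 ⟨(mem_repeated.1 ht).1, h (mem_repeated.1 ht).2⟩

/-- Repeating a suitable window does not increase the cost. -/
lemma exists_repeated_cost_le {ι : Type*} (s : Finset ι) (K H : ι → ℝ) (hH : ∀ i, 0 ≤ H i)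
    (K₀ : ℝ) {T w : ℕ} (hw : 0 < w) {U : Finset ℕ} (hU : U ⊆ Finset.range T) {A : ι → Finset ℕ}
    (hA : ∀ i ∈ s, A i ⊆ Finset.range T) (hAw : ∀ i ∈ s, multiples T w ⊆ A i) :
    ∃ j, (j < T / w ∨ T / w = 0) ∧
      K₀ * (repeated T w j U).card + ∑ i ∈ s, setCost (K i) (H i) T (repeated T w j (A i))
        ≤ K₀ * U.card + ∑ i ∈ s, setCost (K i) (H i) T (A i) := by
  have hcard : ∀ V : Finset ℕ, V ⊆ Finset.range T →
      K₀ * (V.card : ℝ) = ∑ t ∈ Finset.range T, if t ∈ V then K₀ else 0 := by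
    intro V hV
    have := setCost_eq_sum K₀ 0 hV
    simpa [setCost] using this
  have hsum : ∀ (V : Finset ℕ) (B : ι → Finset ℕ), V ⊆ Finset.range T →
      (∀ i ∈ s, B i ⊆ Finset.range T) →
      K₀ * (V.card : ℝ) + ∑ i ∈ s, setCost (K i) (H i) T (B i) =
        ∑ t ∈ Finset.range T, ((if t ∈ V then K₀ else 0)
          + ∑ i ∈ s, ((if t ∈ B i then K i else 0) + H i * held (B i) T t)) := by
    intro V B hV hB
    rw [Finset.sum_add_distrib, Finset.sum_comm, hcard V hV]
    congr 1
    exact Finset.sum_congr rfl fun i hi => setCost_eq_sum _ _ (hB i hi)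
  -- The averaged quantity is the whole cost charged to period `t`: joint order, item orders and
  -- holding. One window must be cheap for all of them simultaneously.
  obtain ⟨j, hj, h⟩ := exists_cheap_window T w (fun t => (if t ∈ U then K₀ else 0)
      + ∑ i ∈ s, ((if t ∈ A i then K i else 0) + H i * held (A i) T t))
  refine ⟨j, hj, ?_⟩
  rw [hsum _ _ (repeated_subset _ _ _ _) (fun i _ => repeated_subset _ _ _ _), hsum _ _ hU hA]
  refine le_trans (Finset.sum_le_sum fun t ht => ?_) h
  have hmem : ∀ V, (t ∈ repeated T w j V ↔ source T w j t ∈ V) := fun V => by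
    rw [mem_repeated, and_iff_right (Finset.mem_range.1 ht)]
  simp only [hmem]
  gcongr with i hi
  · exact hH i
  · exact held_repeated_le hw (hAw i hi) hj t

/-- A frequently ordered item tolerates rounding and an additional order in each window. -/
lemma setCost_rounded_union_le {K H η : ℝ} (hK : 0 ≤ K) (hH : 0 ≤ H) (hη : 0 ≤ η)
    {T d w : ℕ} {A : Finset ℕ} (hT : 0 < T) (hd : 0 < d) (hw : 0 < w) (h0 : 0 ∈ A)
    (hA : A ⊆ Finset.range T)
    (hround : 2 * ((d : ℝ) - 1) * A.card ≤ η * T) (hwin : (T : ℝ) ≤ η * A.card * w) :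
    setCost K H T (roundedOrders T d A ∪ multiples T w) ≤ (1 + η) * setCost K H T A := by
  have hm : (0 : ℝ) < A.card := by exact_mod_cast Finset.card_pos.2 ⟨0, h0⟩
  have hTpos : (0 : ℝ) < T := by exact_mod_cast hT
  have hwpos : (0 : ℝ) < w := by exact_mod_cast hw
  have hcard : ((roundedOrders T d A ∪ multiples T w).card : ℝ) ≤ (1 + η) * A.card := by
    have h1 := (card_union_multiples_le (zero_mem_roundedOrders hT hd h0) T w).trans
      (Nat.add_le_add_right (card_roundedOrders_le T d A) _)
    have h2 : ((roundedOrders T d A ∪ multiples T w).card : ℝ) ≤ A.card + (T / w : ℕ) := by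
      exact_mod_cast h1
    have h3 : ((T / w : ℕ) : ℝ) ≤ (T : ℝ) / w := Nat.cast_div_le
    have h4 : (T : ℝ) / w ≤ η * A.card := by rw [div_le_iff₀ hwpos]; exact hwin
    linarith
  have hheld : ∑ t ∈ Finset.range T, held (roundedOrders T d A ∪ multiples T w) T t ≤
      (1 + η) * ∑ t ∈ Finset.range T, held A T t := by
    have h1 : ∑ t ∈ Finset.range T, held (roundedOrders T d A ∪ multiples T w) T t ≤
        ∑ t ∈ Finset.range T, (held A T t + 2 * ((d : ℝ) - 1)) :=
      Finset.sum_le_sum fun t _ => (held_anti Finset.subset_union_left T t).trans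
        (held_roundedOrders_le hd A T t)
    rw [Finset.sum_add_distrib, Finset.sum_const, Finset.card_range, nsmul_eq_mul] at h1
    have h2 := sq_le_card_mul_sum_held h0 hA
    -- After multiplication by `|A|`, the delay cost is compared with `η T²`, which `h2` bounds by
    -- `η |A|` times the original holding.
    have h3 : (T : ℝ) * (2 * ((d : ℝ) - 1)) ≤ η * ∑ t ∈ Finset.range T, held A T t := by
      refine le_of_mul_le_mul_left ?_ hm
      nlinarith [mul_le_mul_of_nonneg_left hround hTpos.le, mul_le_mul_of_nonneg_left h2 hη]
    linarith
  calc setCost K H T (roundedOrders T d A ∪ multiples T w)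
      ≤ K * ((1 + η) * A.card) + H * ((1 + η) * ∑ t ∈ Finset.range T, held A T t) :=
        add_le_add (mul_le_mul_of_nonneg_left hcard hK) (mul_le_mul_of_nonneg_left hheld hH)
    _ = _ := by rw [setCost]; ring

/-- A rarely ordered item can be ordered periodically at multiples of `G`. -/
lemma exists_multiples_cost_le {K H η : ℝ} (hK : 0 ≤ K) (hH : 0 ≤ H) (hη : 0 ≤ η)
    {T G : ℕ} {A : Finset ℕ} (hT : 0 < T) (hG : 0 < G) (h0 : 0 ∈ A)
    (hA : A ⊆ Finset.range T) (hlong : (G : ℝ) * A.card ≤ η * T) :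
    ∃ r, G ∣ r ∧ setCost K H T (multiples T r) ≤ (1 + η) * setCost K H T A := by
  have hm : 0 < A.card := Finset.card_pos.2 ⟨0, h0⟩
  have hmR : (0 : ℝ) < A.card := by exact_mod_cast hm
  have hTpos : (0 : ℝ) < T := by exact_mod_cast hT
  -- The period `G * q` is the mean gap `T / |A|` rounded up to a multiple of `G`. Rounding `T` to a
  -- multiple of `|A| * G` expresses this without division.
  obtain ⟨q, hq⟩ := dvd_roundUp (A.card * G) T
  have h1 : T ≤ A.card * (G * q) := by
    rw [← mul_assoc, ← hq]; exact le_roundUp (Nat.mul_pos hm hG) T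
  have h2 : A.card * (G * q) ≤ T + A.card * G := by
    rw [← mul_assoc, ← hq]; exact (roundUp_le _ _).trans (by omega)
  have hr : 0 < G * q := Nat.pos_of_ne_zero fun h => by rw [h] at h1; omega
  refine ⟨G * q, dvd_mul_right _ _, ?_⟩
  have hcard : (multiples T (G * q)).card ≤ A.card := by
    have h3 := card_multiples_mul_le hT (G * q)
    have h4 : (multiples T (G * q)).card * (G * q) < (A.card + 1) * (G * q) := by
      rw [add_mul]; omega
    exact Nat.lt_succ_iff.1 (lt_of_mul_lt_mul_right h4 (Nat.zero_le _))
  have hcard' : ((multiples T (G * q)).card : ℝ) ≤ (1 + η) * A.card := by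
    have : ((multiples T (G * q)).card : ℝ) ≤ A.card := by exact_mod_cast hcard
    nlinarith
  have hheld : ∑ t ∈ Finset.range T, held (multiples T (G * q)) T t ≤
      (1 + η) * ∑ t ∈ Finset.range T, held A T t := by
    refine (sum_held_multiples_le hT hr).trans ?_
    have h3 := sq_le_card_mul_sum_held h0 hA
    have h2' : (A.card : ℝ) * ((G * q : ℕ) : ℝ) ≤ T + A.card * G := by exact_mod_cast h2
    refine le_of_mul_le_mul_left ?_ hmR
    nlinarith [mul_le_mul_of_nonneg_left h2' hTpos.le, mul_le_mul_of_nonneg_left hlong hTpos.le,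
      mul_le_mul_of_nonneg_left h3 (show 0 ≤ 1 + η by linarith)]
  calc setCost K H T (multiples T (G * q))
      ≤ K * ((1 + η) * A.card) + H * ((1 + η) * ∑ t ∈ Finset.range T, held A T t) :=
        add_le_add (mul_le_mul_of_nonneg_left hcard' hK) (mul_le_mul_of_nonneg_left hheld hH)
    _ = _ := by rw [setCost]; ring

/-- Take `e = ⌊η T K₀ / (2F)⌋`. As `F ≥ K₀ N`, it is small enough for rounding to be cheap; as a
floor, it is large enough for a grid of step proportional to `e + 1` to be cheap. If `K₀ = 0`, take
`e = 0`. -/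
lemma exists_rounding_unit {K₀ F η : ℝ} (hη : 0 ≤ η) (hη1 : η ≤ 1) (hK₀ : 0 ≤ K₀) {T N : ℕ}
    (hN : 0 < N) (hF : K₀ * N ≤ F) :
    ∃ e ≤ T, 2 * (e : ℝ) * N ≤ η * T ∧ η * T * K₀ ≤ 2 * ((e : ℝ) + 1) * F := by
  have hN1 : (1 : ℝ) ≤ N := by exact_mod_cast hN
  rcases hK₀.eq_or_lt with h | h
  · refine ⟨0, Nat.zero_le _, by simp; positivity, ?_⟩
    rw [← h] at hF ⊢
    simp at hF ⊢; exact hF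
  · have hFpos : 0 < F := lt_of_lt_of_le (by positivity) hF
    have hy : 0 ≤ η * T * K₀ / (2 * F) := by positivity
    have h1 : (⌊η * T * K₀ / (2 * F)⌋₊ : ℝ) ≤ η * T * K₀ / (2 * F) := Nat.floor_le hy
    have h2 := Nat.lt_floor_add_one (η * T * K₀ / (2 * F))
    rw [le_div_iff₀ (by positivity)] at h1
    rw [div_lt_iff₀ (by positivity)] at h2
    set e := ⌊η * T * K₀ / (2 * F)⌋₊ with he
    have h3 : 2 * (e : ℝ) * N ≤ η * T := by
      refine le_of_mul_le_mul_right ?_ h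
      have : 2 * (e : ℝ) * (K₀ * N) ≤ 2 * (e : ℝ) * F := by gcongr
      nlinarith
    refine ⟨e, ?_, h3, by linarith⟩
    have he0 : (0 : ℝ) ≤ e := Nat.cast_nonneg e
    have : (e : ℝ) ≤ T := by
      have hT0 : (0 : ℝ) ≤ T := Nat.cast_nonneg T
      nlinarith
    exact_mod_cast this

/-- Round, add the grid, and repeat the best window for the frequently ordered items. The grid and
the item costs account for one factor `1 + η` each, and additively for `1 + 2η`. -/
theorem exists_candidate_jointValue_le (I : Inst) {P : I.Policy} (hP : I.Feasible P) {η : ℝ}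
    (hη : 0 < η) (hη1 : η ≤ 1) {g : ℕ} (hg : 2 ≤ (g : ℝ) * η ^ 2) :
    ∃ e ≤ I.T, ∃ x < 2 ^ (g * g + g * g),
      I.jointValue (candidate I.T (g * g) (e + 1) x) ≤ (1 + 2 * η) * I.cost P := by
  classical
  have hT := I.T_pos
  have hgR : (0 : ℝ) < g := by
    by_contra h
    have : (g : ℝ) * η ^ 2 ≤ 0 := mul_nonpos_of_nonpos_of_nonneg (not_lt.1 h) (by positivity)
    linarith
  have hgpos : 0 < g := by exact_mod_cast hgR
  set U := I.jointTimes P with hUdef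
  have h0 : ∀ i, 0 ∈ (P i).times := fun i => (hP i).zero_mem_times hT
  have hsub : ∀ i, (P i).times ⊆ U := fun i => Inst.times_subset_jointTimes P i
  have h0U : 0 ∈ U := hsub ⟨0, I.n_pos⟩ (h0 _)
  have hcost : I.K₀ * U.card + ∑ i, setCost (I.K i) (I.H i) I.T (P i).times ≤ I.cost P := by
    rw [Inst.cost, hUdef, Inst.card_jointTimes]
    exact add_le_add le_rfl
      (Finset.sum_le_sum fun i _ => (hP i).setCost_le_cost (I.K i) (I.H_nonneg i))
  have hFN : I.K₀ * U.card ≤ I.cost P :=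
    le_trans (le_add_of_nonneg_right
      (Finset.sum_nonneg fun i _ => setCost_nonneg (I.K_nonneg i) (I.H_nonneg i) _ _)) hcost
  obtain ⟨e, heT, he1, he2⟩ := exists_rounding_unit (T := I.T) hη.le hη1 I.K₀_nonneg
    (Finset.card_pos.2 ⟨0, h0U⟩) hFN
  set d := e + 1 with hd
  have hdpos : 0 < d := Nat.succ_pos e
  have hde : (d : ℝ) - 1 = e := by rw [hd]; push_cast; ring
  set G := g * d with hGdef
  have hGpos : 0 < G := Nat.mul_pos hgpos hdpos
  have hGR : (G : ℝ) = g * d := by rw [hGdef]; push_cast; ring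
  set w := g * g * d with hwdef
  have hwpos : 0 < w := Nat.mul_pos (Nat.mul_pos hgpos hgpos) hdpos
  have hwR : (w : ℝ) = g * g * d := by rw [hwdef]; push_cast; ring
  have hGw : G ∣ w := ⟨g, by rw [hGdef, hwdef]; ring⟩
  have hdG : d ∣ G := Dvd.intro_left _ rfl
  set U' := roundedOrders I.T d U ∪ multiples I.T G with hU'
  have hU'sub : U' ⊆ Finset.range I.T :=
    Finset.union_subset (roundedOrders_subset _ _ _) (Finset.filter_subset _ _)
  have hU'd : ∀ t ∈ U', d ∣ t := by
    intro t ht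
    rcases Finset.mem_union.1 ht with h | h
    · exact dvd_of_mem_roundedOrders h
    · exact hdG.trans (mem_multiples.1 h).2
  have hmulU' : multiples I.T w ⊆ U' := fun t ht =>
    Finset.mem_union_right _ (mem_multiples.2
      ⟨(mem_multiples.1 ht).1, hGw.trans (mem_multiples.1 ht).2⟩)
  have hjoint : I.K₀ * U'.card ≤ I.K₀ * U.card + η * I.cost P := by
    have h1 := (card_union_multiples_le (zero_mem_roundedOrders hT hdpos h0U) I.T G).trans
      (Nat.add_le_add_right (card_roundedOrders_le I.T d U) _)
    have h2 : (U'.card : ℝ) ≤ U.card + (I.T / G : ℕ) := by exact_mod_cast h1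
    have h3 : ((I.T / G : ℕ) : ℝ) ≤ (I.T : ℝ) / G := Nat.cast_div_le
    -- The lower bound on `e + 1` gives `η T K₀ ≤ 2 d F`, and `g η² ≥ 2` turns this into `K₀ T / (g
    -- d) ≤ η F`.
    have h4 : I.K₀ * ((I.T : ℝ) / G) ≤ η * I.cost P := by
      rw [← mul_div_assoc, div_le_iff₀ (by exact_mod_cast hGpos), hGR]
      have he2' : η * I.T * I.K₀ ≤ 2 * d * I.cost P := by rw [hd]; push_cast; exact he2
      have hF0 : 0 ≤ I.cost P := le_trans (by have := I.K₀_nonneg; positivity) hFN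
      have h5 : 2 * (d * I.cost P) ≤ (g : ℝ) * η ^ 2 * (d * I.cost P) := by gcongr
      refine le_of_mul_le_mul_left ?_ hη
      nlinarith
    calc I.K₀ * U'.card ≤ I.K₀ * (U.card + (I.T : ℝ) / G) :=
          mul_le_mul_of_nonneg_left (by linarith) I.K₀_nonneg
      _ ≤ _ := by rw [mul_add]; linarith
  -- The items with mean gap below `G / η`.
  set short : Finset (Fin I.n) :=
    Finset.univ.filter fun i => η * I.T < (G : ℝ) * (P i).times.card with hshort
  set A : Fin I.n → Finset ℕ :=
    fun i => roundedOrders I.T d (P i).times ∪ multiples I.T w with hAdef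
  have hAshort : ∀ i ∈ short, setCost (I.K i) (I.H i) I.T (A i) ≤
      (1 + η) * setCost (I.K i) (I.H i) I.T (P i).times := by
    intro i hi
    have hi' : η * I.T < (G : ℝ) * (P i).times.card := by simpa [hshort] using hi
    have hcle : ((P i).times.card : ℝ) ≤ U.card := by
      exact_mod_cast Finset.card_le_card (hsub i)
    refine setCost_rounded_union_le (I.K_nonneg i) (I.H_nonneg i) hη.le hT hdpos hwpos (h0 i)
      (P i).times_subset ?_ ?_
    · rw [hde]
      refine le_trans ?_ he1
      gcongr
    -- Orders at multiples of `w = g G` are few compared with the more than `η T / G` orders of the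
    -- item, again by `g η² ≥ 2`.
    · rw [hGR] at hi'
      rw [hwR]
      have hX : 0 ≤ (g : ℝ) * d * (P i).times.card := by positivity
      refine le_of_mul_le_mul_left ?_ hη
      nlinarith
  -- Only the short items enter the choice of the window: the others will use grid points alone,
  -- whichever window is repeated.
  obtain ⟨j, hj, hrep⟩ := exists_repeated_cost_le short I.K I.H I.H_nonneg I.K₀ hwpos hU'sub
    (A := A) (fun i _ => Finset.union_subset (roundedOrders_subset _ _ _)
      (Finset.filter_subset _ _))
    (fun i _ => Finset.subset_union_right)
  obtain ⟨x, hx, hxS⟩ := exists_candidate_eq_repeated hT hdpos (Nat.mul_pos hgpos hgpos) hU'd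
    hmulU' hj
  refine ⟨e, heT, x, hx, ?_⟩
  rw [hxS]
  -- The period is chosen for all items at once; its value `0` on short items is a dummy.
  have hlong : ∀ i, ∃ r, i ∉ short → G ∣ r ∧ setCost (I.K i) (I.H i) I.T (multiples I.T r) ≤
      (1 + η) * setCost (I.K i) (I.H i) I.T (P i).times := by
    intro i
    by_cases hi : i ∈ short
    · exact ⟨0, fun h => absurd hi h⟩
    · have hi' : (G : ℝ) * (P i).times.card ≤ η * I.T := by simpa [hshort] using hi
      obtain ⟨r, hr⟩ := exists_multiples_cost_le (I.K_nonneg i) (I.H_nonneg i) hη.le hT hGpos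
        (h0 i) (P i).times_subset hi'
      exact ⟨r, fun _ => hr⟩
  choose r hr using hlong
  have hrepzero : ∀ B, multiples I.T w ⊆ B → 0 ∈ repeated I.T w j B := fun B hB =>
    mem_repeated.2 ⟨hT, hB (mem_multiples.2 ⟨source_lt hj hT, dvd_source dvd_rfl (dvd_zero _)⟩)⟩
  have hval := I.jointValue_le (S := repeated I.T w j U')
    (A := fun i => if i ∈ short then repeated I.T w j (A i) else multiples I.T (r i))
    (fun i => by
      split_ifs with hi
      · refine repeated_mono _ _ _ (Finset.union_subset ?_ hmulU')
        exact (roundedOrders_mono _ _ (hsub i)).trans Finset.subset_union_left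
      · intro t ht
        obtain ⟨ht1, ht2⟩ := mem_multiples.1 ht
        exact mem_repeated.2 ⟨ht1, Finset.mem_union_right _ (mem_multiples.2
          ⟨source_lt hj ht1, dvd_source hGw ((hr i hi).1.trans ht2)⟩)⟩)
    (fun i => by
      split_ifs with hi
      · exact hrepzero _ Finset.subset_union_right
      · exact mem_multiples.2 ⟨hT, dvd_zero _⟩)
  refine hval.trans ?_
  have hsplit : ∀ f : Fin I.n → ℝ, ∑ i, f i = ∑ i ∈ short, f i + ∑ i ∈ shortᶜ, f i :=
    fun f => (Finset.sum_add_sum_compl short f).symm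
  rw [hsplit] at hcost ⊢
  have e1 : ∑ i ∈ short, setCost (I.K i) (I.H i) I.T
      (if i ∈ short then repeated I.T w j (A i) else multiples I.T (r i)) =
      ∑ i ∈ short, setCost (I.K i) (I.H i) I.T (repeated I.T w j (A i)) :=
    Finset.sum_congr rfl fun i hi => by rw [if_pos hi]
  have e2 : ∑ i ∈ shortᶜ, setCost (I.K i) (I.H i) I.T
      (if i ∈ short then repeated I.T w j (A i) else multiples I.T (r i)) ≤
      (1 + η) * ∑ i ∈ shortᶜ, setCost (I.K i) (I.H i) I.T (P i).times := by
    rw [Finset.mul_sum]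
    refine Finset.sum_le_sum fun i hi => ?_
    rw [if_neg (Finset.mem_compl.1 hi)]
    exact (hr i (Finset.mem_compl.1 hi)).2
  have e3 : ∑ i ∈ short, setCost (I.K i) (I.H i) I.T (A i) ≤
      (1 + η) * ∑ i ∈ short, setCost (I.K i) (I.H i) I.T (P i).times := by
    rw [Finset.mul_sum]; exact Finset.sum_le_sum hAshort
  rw [e1]
  -- The joint orders lose `η F` and the items lose `η` times their own cost. Adding the slack `η K₀
  -- |U|` bounds the latter by `η F` as well.
  have hK0U : 0 ≤ η * (I.K₀ * U.card) := by have := I.K₀_nonneg; positivity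
  have := mul_le_mul_of_nonneg_left hcost (show 0 ≤ 1 + η by linarith)
  linarith

/-! ## Reasoning about programs -/

namespace State

lemma writeNat_nat (s : State) (a i v b : ℕ) :
    (s.writeNat a i v).nat b = if b = a then Function.update (s.nat a) i v else s.nat b := by
  unfold writeNat
  split_ifs with h
  · subst h; simp
  · simp [h]

@[simp] lemma writeNat_real (s : State) (a i v : ℕ) : (s.writeNat a i v).real = s.real := rfl

lemma writeReal_real (s : State) (a i : ℕ) (v : ℝ) (b : ℕ) :
    (s.writeReal a i v).real b = if b = a then Function.update (s.real a) i v else s.real b := by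
  unfold writeReal
  split_ifs with h
  · subst h; simp
  · simp [h]

@[simp] lemma writeReal_nat (s : State) (a i : ℕ) (v : ℝ) : (s.writeReal a i v).nat = s.nat := rfl

end State

namespace Prog

/-- The natural arrays that a program may write to. -/
def natMods : Prog → List ℕ
  | skip => []
  | setNat a _ _ => [a]
  | setReal _ _ _ => []
  | seq p q => p.natMods ++ q.natMods
  | ite _ p q => p.natMods ++ q.natMods
  | loop _ p => p.natMods

/-- The real arrays that a program may write to. -/
def realMods : Prog → List ℕ
  | skip => []
  | setNat _ _ _ => []
  | setReal a _ _ => [a]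
  | seq p q => p.realMods ++ q.realMods
  | ite _ p q => p.realMods ++ q.realMods
  | loop _ p => p.realMods

end Prog

/-- `s` and `s'` agree on all arrays that `p` does not write to. -/
structure Agree (p : Prog) (s s' : State) : Prop where
  nat : ∀ a, a ∉ p.natMods → s'.nat a = s.nat a
  real : ∀ a, a ∉ p.realMods → s'.real a = s.real a

lemma Agree.refl (p : Prog) (s : State) : Agree p s s := ⟨fun _ _ => rfl, fun _ _ => rfl⟩

lemma Agree.trans {p : Prog} {s s₁ s₂ : State} (h : Agree p s s₁) (h' : Agree p s₁ s₂) :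
    Agree p s s₂ :=
  ⟨fun a ha => (h'.nat a ha).trans (h.nat a ha), fun a ha => (h'.real a ha).trans (h.real a ha)⟩

lemma Agree.mono {p q : Prog} {s s' : State} (h : Agree p s s') (hn : p.natMods ⊆ q.natMods)
    (hr : p.realMods ⊆ q.realMods) : Agree q s s' :=
  ⟨fun a ha => h.nat a fun h' => ha (hn h'), fun a ha => h.real a fun h' => ha (hr h')⟩

/-- A frame rule. For a concrete program, that an array is not written to is settled by `decide`. -/
theorem Exec.agree {p : Prog} {s s' : State} {k : ℕ} (h : Exec p s k s') : Agree p s s' := by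
  induction h with
  | skip s => exact Agree.refl _ _
  | setNat a i e s =>
    refine ⟨fun b hb => ?_, fun b _ => rfl⟩
    rw [State.writeNat_nat, if_neg (by simpa [Prog.natMods] using hb)]
  | setReal a i e s =>
    refine ⟨fun b _ => rfl, fun b hb => ?_⟩
    rw [State.writeReal_real, if_neg (by simpa [Prog.realMods] using hb)]
  | seq _ _ ih₁ ih₂ =>
    exact (ih₁.mono (List.subset_append_left _ _) (List.subset_append_left _ _)).trans
      (ih₂.mono (List.subset_append_right _ _) (List.subset_append_right _ _))
  | iteTrue q _ _ ih =>
    exact ih.mono (List.subset_append_left _ _) (List.subset_append_left _ _)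
  | iteFalse p _ _ ih =>
    exact ih.mono (List.subset_append_right _ _) (List.subset_append_right _ _)
  | loopStop p _ => exact Agree.refl _ _
  | loopStep _ _ _ ih₁ ih₂ =>
    refine Agree.trans ?_ ih₂
    exact (ih₁.mono (List.Subset.refl _) (List.Subset.refl _))

/-- Started in `s`, the program `p` halts within `B` operations in a state that satisfies `Q`. -/
def Runs (p : Prog) (s : State) (B : ℕ) (Q : State → Prop) : Prop :=
  ∃ k s', Exec p s k s' ∧ k ≤ B ∧ Q s'

namespace Runs

variable {p q : Prog} {s : State} {B C : ℕ} {Q R : State → Prop}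

/-- The frame property is offered at every weakening, so specifications need not mention untouched
arrays. -/
lemma mono (h : Runs p s B Q) (hB : B ≤ C) (hQ : ∀ s', Agree p s s' → Q s' → R s') :
    Runs p s C R := by
  obtain ⟨k, s', he, hk, h⟩ := h
  exact ⟨k, s', he, hk.trans hB, hQ s' he.agree h⟩

lemma bound (h : Runs p s B Q) (hB : B ≤ C) : Runs p s C Q := h.mono hB fun _ _ h => h

lemma skip (h : Q s) : Runs .skip s 1 Q := ⟨1, s, .skip s, le_rfl, h⟩

lemma setNat {a : ℕ} {i e : NExpr} (h : Q (s.writeNat a (i.eval s) (e.eval s))) :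
    Runs (.setNat a i e) s (i.ops + e.ops + 1) Q := ⟨_, _, .setNat a i e s, le_rfl, h⟩

lemma setReal {a : ℕ} {i : NExpr} {e : RExpr} (h : Q (s.writeReal a (i.eval s) (e.eval s))) :
    Runs (.setReal a i e) s (i.ops + e.ops + 1) Q := ⟨_, _, .setReal a i e s, le_rfl, h⟩

lemma seq (h : Runs p s B fun s₁ => Runs q s₁ C Q) : Runs (.seq p q) s (B + C) Q := by
  obtain ⟨k, s₁, he, hk, l, s₂, he', hl, hQ⟩ := h
  exact ⟨_, s₂, .seq he he', by omega, hQ⟩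

lemma ite {b : BExpr} (h : b.Holds s → Runs p s B Q) (h' : ¬ b.Holds s → Runs q s C Q) :
    Runs (.ite b p q) s (b.ops + (B + C) + 1) Q := by
  by_cases hb : b.Holds s
  · obtain ⟨k, s', he, hk, hQ⟩ := h hb
    exact ⟨_, s', .iteTrue q hb he, by omega, hQ⟩
  · obtain ⟨k, s', he, hk, hQ⟩ := h' hb
    exact ⟨_, s', .iteFalse p hb he, by omega, hQ⟩

/-- A loop that makes exactly `N` rounds. -/
lemma loop {b : BExpr} (N : ℕ) (Inv : ℕ → State → Prop) (h0 : Inv 0 s)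
    (step : ∀ j < N, ∀ s', Inv j s' → Agree (.loop b p) s s' →
      b.Holds s' ∧ Runs p s' B (Inv (j + 1)))
    (atEnd : ∀ s', Inv N s' → Agree (.loop b p) s s' → ¬ b.Holds s' ∧ Q s') :
    Runs (.loop b p) s (N * (b.ops + 1 + B) + (b.ops + 1)) Q := by
  have key : ∀ m ≤ N, ∀ s', Inv (N - m) s' → Agree (.loop b p) s s' →
      Runs (.loop b p) s' (m * (b.ops + 1 + B) + (b.ops + 1)) Q := by
    intro m
    induction m with
    | zero =>
      intro _ s' hI ha
      obtain ⟨hb, hQ⟩ := atEnd s' hI ha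
      exact ⟨_, s', .loopStop p hb, by omega, hQ⟩
    | succ m ih =>
      intro hm s' hI ha
      obtain ⟨hb, k, s₁, he, hk, hI'⟩ := step _ (by omega) s' hI ha
      rw [show N - (m + 1) + 1 = N - m by omega] at hI'
      obtain ⟨l, s₂, he', hl, hQ⟩ := ih (by omega) s₁ hI'
        (ha.trans (he.agree.mono (List.Subset.refl _) (List.Subset.refl _)))
      refine ⟨_, s₂, .loopStep hb he he', ?_, hQ⟩
      rw [add_mul, one_mul]; omega
  exact key N le_rfl s (by simpa using h0) (Agree.refl _ _)

end Runs

namespace Prog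

/-- The counting loop `for v < e`; the counter is cell `0` of the array `v`. -/
def forLoop (v : ℕ) (e : NExpr) (p : Prog) : Prog :=
  .seq (.setNat v (.lit 0) (.lit 0))
    (.loop (.natLe (.add (.get v (.lit 0)) (.lit 1)) e)
      (.seq p (.setNat v (.lit 0) (.add (.get v (.lit 0)) (.lit 1)))))

end Prog

/-- The bound `e` is evaluated anew in each round, hence `hN` asks for its value in all reachable
states. The invariant has to survive writes to the counter, which happen outside the body. -/
lemma Runs.forLoop {v : ℕ} {e : NExpr} {p : Prog} {s : State} {B : ℕ} {Q : State → Prop} (N : ℕ)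
    (Inv : ℕ → State → Prop) (hv : v ∉ p.natMods)
    (hN : ∀ s', Agree (.forLoop v e p) s s' → e.eval s' = N)
    (hInv : ∀ j s' x, Inv j s' → Inv j (s'.writeNat v 0 x)) (h0 : Inv 0 s)
    (step : ∀ j < N, ∀ s', Inv j s' → s'.nat v 0 = j → Agree (.forLoop v e p) s s' →
      Runs p s' B (Inv (j + 1)))
    (atEnd : ∀ s', Inv N s' → Agree (.forLoop v e p) s s' → Q s') :
    Runs (.forLoop v e p) s (N * (e.ops + B + 12) + (e.ops + 12)) Q := by
  have hsub1 : ∀ b, (Prog.loop b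
      (.seq p (.setNat v (.lit 0) (.add (.get v (.lit 0)) (.lit 1))))).natMods
      ⊆ (Prog.forLoop v e p).natMods := fun b => List.subset_append_right _ _
  have hsub2 : ∀ b, (Prog.loop b
      (.seq p (.setNat v (.lit 0) (.add (.get v (.lit 0)) (.lit 1))))).realMods
      ⊆ (Prog.forLoop v e p).realMods := fun b => List.subset_append_right _ _
  have ha0 : Agree (.forLoop v e p) s (s.writeNat v 0 0) := by
    refine ⟨fun a ha => ?_, fun a _ => rfl⟩
    rw [State.writeNat_nat, if_neg]
    rintro rfl
    exact ha (by simp [Prog.forLoop, Prog.natMods])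
  refine Runs.bound (Runs.seq (Runs.setNat (Runs.loop (B := B + 6) (Q := Q) N
    (fun j s' => Inv j s' ∧ s'.nat v 0 = j) ?_ ?_ ?_))) ?_
  · exact ⟨hInv 0 s 0 h0, by simp [State.writeNat_nat, NExpr.eval]⟩
  · rintro j hj s' ⟨hI, hjv⟩ ha
    have ha' := ha0.trans (ha.mono (hsub1 _) (hsub2 _))
    refine ⟨?_, ?_⟩
    · simp only [BExpr.Holds, NExpr.eval, hN s' ha', hjv]; omega
    · refine Runs.bound (Runs.seq (Runs.mono (step j hj s' hI hjv ha') le_rfl ?_))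
        (C := B + 6) le_rfl
      intro s₁ hs₁ hI₁
      refine (Runs.setNat ⟨hInv _ _ _ hI₁, ?_⟩).bound (by simp [NExpr.ops])
      simp [State.writeNat_nat, NExpr.eval, hs₁.nat v hv, hjv]
  · rintro s' ⟨hI, hjv⟩ ha
    have ha' := ha0.trans (ha.mono (hsub1 _) (hsub2 _))
    refine ⟨?_, atEnd s' hI ha'⟩
    simp only [BExpr.Holds, NExpr.eval, hN s' ha', hjv]; omega
  · simp only [NExpr.ops, BExpr.ops]
    rw [show 2 + 1 + 1 + e.ops + 1 = e.ops + 5 by ring]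
    nlinarith

/-! ## The dynamic program of an item -/

/-- `V t` is the least cost from `t` on if the item is ordered at `t`, and `nx t` is an optimal
time for the following order. -/
structure OptimalAt (K H : ℝ) (T : ℕ) (S : Finset ℕ) (V : ℕ → ℝ) (nx : ℕ → ℕ) (t : ℕ) : Prop where
  lt : t < nx t
  le : nx t ≤ T
  mem : nx t = T ∨ nx t ∈ S
  eq : V t = K + H * ((nx t : ℝ) - t) ^ 2 + V (nx t)
  min : ∀ s, t < s → s = T ∨ s ∈ S → V t ≤ K + H * ((s : ℝ) - t) ^ 2 + V s

/-- The first order at or after `t`, if `nx` tells the successor of an order. -/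
def chain (nx : ℕ → ℕ) : ℕ → ℕ
  | 0 => 0
  | t + 1 => if chain nx t ≤ t then nx t else chain nx t

/-- The orders reached from `0` along `nx`. -/
def chainOrders (T : ℕ) (nx : ℕ → ℕ) : Finset ℕ := (Finset.range T).filter fun t => chain nx t ≤ t

section

variable {K H : ℝ} {T : ℕ} {S : Finset ℕ} {V : ℕ → ℝ} {nx : ℕ → ℕ}

lemma le_chain (h : ∀ t < T, OptimalAt K H T S V nx t) :
    ∀ t ≤ T, t ≤ chain nx t ∧ chain nx t ≤ T := by
  intro t
  induction t with
  | zero => simp [chain]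
  | succ t ih =>
    intro ht
    have ih := ih (by omega)
    have h1 := (h t (by omega)).lt
    have h2 := (h t (by omega)).le
    simp only [chain]
    split_ifs <;> omega

lemma chain_mem (h : ∀ t < T, OptimalAt K H T S V nx t) (h0 : 0 ∈ S) :
    ∀ t ≤ T, chain nx t = T ∨ chain nx t ∈ S := by
  intro t
  induction t with
  | zero => simp [chain, h0]
  | succ t ih =>
    intro ht
    simp only [chain]
    split_ifs
    · exact (h t (by omega)).mem
    · exact ih (by omega)

lemma chainOrders_subset (h : ∀ t < T, OptimalAt K H T S V nx t) (h0 : 0 ∈ S) :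
    chainOrders T nx ⊆ S := by
  intro t ht
  simp only [chainOrders, Finset.mem_filter, Finset.mem_range] at ht
  have h1 := (le_chain h t ht.1.le).1
  rcases chain_mem h h0 t ht.1.le with h2 | h2
  · omega
  · rwa [show t = chain nx t by omega]

lemma zero_mem_chainOrders (hT : 0 < T) : 0 ∈ chainOrders T nx := by simp [chainOrders, hT, chain]

/-- Between two points of the chain `chain` stays constant, and at a point of the chain it is that
point; backward induction compares the two functions. -/
lemma nextOrder_chainOrders (h : ∀ t < T, OptimalAt K H T S V nx t) :
    ∀ t ≤ T, nextOrder (chainOrders T nx) T t = chain nx t := by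
  intro t ht
  induction ht using Nat.decreasingInduction with
  | self =>
    have := le_chain h T le_rfl
    rw [nextOrder_self]; omega
  | of_succ t ht ih =>
    have h1 := le_chain h t ht.le
    by_cases hc : chain nx t ≤ t
    · rw [nextOrder_of_mem (by simp [chainOrders, ht, hc]) ht.le]; omega
    · rw [nextOrder_of_notMem T (by simp [chainOrders, hc]), ih]
      simp [chain, hc]

/-- Along the chain every gap attains equality in the Bellman equation, so all terms of the
telescoped cost vanish. -/
lemma setCost_chainOrders (h : ∀ t < T, OptimalAt K H T S V nx t) (hT : 0 < T) (hV : V T = 0) :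
    setCost K H T (chainOrders T nx) = V 0 := by
  have e := setCost_add_potential K H T (chainOrders T nx) (zero_mem_chainOrders hT)
    (Finset.filter_subset _ _) V
  rw [Finset.sum_eq_zero] at e
  · linarith
  · intro t ht
    simp only [chainOrders, Finset.mem_filter, Finset.mem_range] at ht
    rw [nextOrder_chainOrders h _ ht.1]
    simp only [chain, ht.2, if_true]
    rw [(h t ht.1).eq]; ring

/-- The chain attains `V 0`; conversely the minimality of `V` makes it a lower-bounding potential
for every other ordering set. -/
lemma sInf_itemCosts_eq (h : ∀ t < T, OptimalAt K H T S V nx t) (hT : 0 < T) (hV : V T = 0)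
    (hS : S ⊆ Finset.range T) (h0 : 0 ∈ S) : sInf (itemCosts K H T S) = V 0 := by
  refine IsLeast.csInf_eq ⟨⟨chainOrders T nx, chainOrders_subset h h0, zero_mem_chainOrders hT,
    (setCost_chainOrders h hT hV).symm⟩, ?_⟩
  rintro _ ⟨A, hA, hA0, rfl⟩
  have := le_setCost_of_potential (K := K) (H := H) hA0 (hA.trans hS) V fun t ht => by
    have htT := Finset.mem_range.1 (hS (hA ht))
    refine (h t htT).min _ (le_nextOrder htT) ?_
    rcases nextOrder_eq_or_mem A T (t + 1) with h' | h'
    · exact Or.inl h'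
    · exact Or.inr (hA h'.1)
  linarith

/-- The policy that follows the chain of `nx` is feasible and has the computed cost. -/
lemma feasible_and_cost_of_chain (h : ∀ t < T, OptimalAt K H T S V nx t) (hT : 0 < T)
    (hV : V T = 0) (h0 : 0 ∈ S) {P : ItemPolicy T}
    (hO : ∀ t : Fin T, t ∈ P.orders ↔ chain nx t ≤ t)
    (hq : ∀ t : Fin T, P.qty t = if chain nx t ≤ t then ((nx t - t : ℕ) : ℝ) else 0) :
    P.Feasible ∧ P.cost K H = V 0 ∧ P.times ⊆ S := by
  have htimes : P.times = chainOrders T nx := by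
    ext t
    simp only [ItemPolicy.mem_times, chainOrders, Finset.mem_filter, Finset.mem_range]
    constructor
    · rintro ⟨s, hs, rfl⟩; exact ⟨s.2, (hO s).1 hs⟩
    · rintro ⟨h1, h2⟩; exact ⟨⟨t, h1⟩, (hO _).2 h2, rfl⟩
  -- The quantities `nx s - s` telescope: what has been ordered before `t` lasts exactly until the
  -- next point of the chain.
  have hsum : ∀ t ≤ T, ∑ s ∈ (chainOrders T nx).filter (· < t), ((nx s - s : ℕ) : ℝ)
      = chain nx t := by
    intro t
    induction t with
    | zero => simp [chain]
    | succ t ih =>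
      intro ht
      have ih := ih (by omega)
      rw [filter_lt_succ]
      by_cases hc : chain nx t ≤ t
      · rw [if_pos (by simp [chainOrders, hc]; omega), Finset.sum_insert (by simp), ih]
        have h1 := (le_chain h t (by omega)).1
        have h2 := (h t ht).lt
        have : nx t - t + chain nx t = chain nx (t + 1) := by simp only [chain, if_pos hc]; omega
        exact_mod_cast this
      · rw [if_neg (by simp [chainOrders, hc]), ih]
        simp [chain, hc]
  have hord : ∀ t < T, P.ordered t = chain nx (t + 1) := by
    intro t ht
    rw [← hsum (t + 1) ht, ← htimes, ItemPolicy.times, Finset.filter_map, Finset.sum_map]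
    refine Finset.sum_congr (by ext s; simp) fun s hs => ?_
    rw [hq, if_pos ((hO s).1 (Finset.mem_filter.1 hs).1)]; rfl
  refine ⟨⟨fun t _ => ?_, fun τ hτ => ?_⟩, ?_, htimes ▸ chainOrders_subset h h0⟩
  · rw [hq]; split_ifs <;> positivity
  · have h1 := Nat.floor_le hτ.1
    have h2 := Nat.lt_floor_add_one τ
    have h3 : ⌊τ⌋₊ < T := by exact_mod_cast h1.trans_lt hτ.2
    rw [P.inventory_eq h1 h2, hord _ h3]
    have h4 : ((⌊τ⌋₊ + 1 : ℕ) : ℝ) ≤ chain nx (⌊τ⌋₊ + 1) := by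
      exact_mod_cast (le_chain h _ h3).1
    push_cast at h4; linarith
  · rw [← setCost_chainOrders h hT hV, P.cost_eq, htimes, setCost]
    congr 2
    refine Finset.sum_congr rfl fun t ht => ?_
    have ht := Finset.mem_range.1 ht
    rw [hord t ht, held, nextOrder_chainOrders h _ ht]

end

/-! ## Building a candidate -/

/-- Cell `0` of a natural array, used as a variable. -/
abbrev nvar (a : ℕ) : NExpr := .get a (.lit 0)

/-- The bit that is decoded in round `nvar 9`. -/
def bitIndex : NExpr := .sub (.add (nvar 3) (nvar 3)) (.add (nvar 9) (.lit 1))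

/-- Greedy decoding from the most significant bit: a bit is set iff its power of two still fits into
the remainder. -/
def decodeStep : Prog :=
  .ite (.natLe (.get 4 bitIndex) (nvar 8))
    (.seq (.setNat 7 bitIndex (.lit 1)) (.setNat 8 (.lit 0) (.sub (nvar 8) (.get 4 bitIndex))))
    (.setNat 7 bitIndex (.lit 0))

/-- Stores the binary digits of `nvar 6` in the array `7`, using the powers of two in array `4`. -/
def decodeBits : Prog :=
  .seq (.setNat 8 (.lit 0) (nvar 6)) (.forLoop 9 (.add (nvar 3) (nvar 3)) decodeStep)

lemma runs_decodeBits {s : State} {W x : ℕ} (hW : s.nat 3 0 = W)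
    (hp : ∀ j ≤ W + W, s.nat 4 j = 2 ^ j) (hx : s.nat 6 0 = x) (hlt : x < 2 ^ (W + W)) :
    Runs decodeBits s ((W + W) * 100 + 100)
      (fun s' => ∀ u < W + W, s'.nat 7 u = (x.testBit u).toNat) := by
  -- After `j` rounds the remainder is `x` modulo `2 ^ (2W - j)`, and the top `j` bits are known.
  refine Runs.bound (Runs.seq (Runs.setNat (Runs.forLoop (W + W)
    (fun j s' => s'.nat 8 0 = x % 2 ^ (W + W - j) ∧
      ∀ u, W + W - j ≤ u → u < W + W → s'.nat 7 u = (x.testBit u).toNat)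
    (B := 80) (by decide) ?_ (fun j s' y h => h) ?_ ?_ ?_))) ?_
  · intro s' ha
    have := congrFun (ha.nat 3 (by decide)) 0
    simp [State.writeNat_nat, NExpr.eval, hW] at this ⊢
    omega
  · simp [State.writeNat_nat, NExpr.eval, hx, Nat.mod_eq_of_lt hlt]
    intro u h1 h2; omega
  · rintro j hj s' ⟨hy, hb⟩ hjv ha
    have h3 := congrFun (ha.nat 3 (by decide)) 0
    have h4 := ha.nat 4 (by decide)
    simp [State.writeNat_nat, hW] at h3 h4
    obtain ⟨i, hi⟩ : ∃ i, W + W - j = i + 1 := ⟨W + W - j - 1, by omega⟩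
    have hidx : bitIndex.eval s' = i := by
      simp [bitIndex, NExpr.eval, h3, hjv]; omega
    have hpi : s'.nat 4 i = 2 ^ i := by rw [h4, hp i (by omega)]
    have hi' : W + W - (j + 1) = i := by omega
    have hmod : x % 2 ^ (i + 1) = x % 2 ^ i + 2 ^ i * (x.testBit i).toNat := by
      rw [pow_succ, Nat.mod_mul, Nat.toNat_testBit]
    have hmodlt := Nat.mod_lt x (Nat.two_pow_pos i)
    rw [hi] at hy hb
    rw [hi']
    refine Runs.bound (Runs.ite (fun hc => Runs.seq (Runs.setNat (Runs.setNat ?_)))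
      (fun hc => Runs.setNat ?_)) (C := 80) (by decide)
    · simp only [BExpr.Holds, NExpr.eval, hidx, hpi, hy] at hc
      have hbit : x.testBit i = true := by
        by_contra h
        rw [eq_false_of_ne_true h, Bool.toNat_false] at hmod; omega
      rw [hbit, Bool.toNat_true] at hmod
      refine ⟨?_, fun u hu1 hu2 => ?_⟩
      · have hidx2 : bitIndex.eval (s'.writeNat 7 i 1) = i := by
          rw [← hidx]; simp [bitIndex, NExpr.eval, State.writeNat_nat]
        simp [State.writeNat_nat, NExpr.eval, hidx, hidx2, hpi, hy]; omega
      · simp only [State.writeNat_nat, NExpr.eval, hidx]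
        rcases hu1.eq_or_lt with h | h
        · subst h; simp [hbit]
        · simp [h.ne', hb u h hu2]
    · simp only [BExpr.Holds, NExpr.eval, hidx, hpi, hy] at hc
      have hbit : x.testBit i = false := by
        by_contra h
        rw [eq_true_of_ne_false h, Bool.toNat_true] at hmod; omega
      rw [hbit, Bool.toNat_false] at hmod
      refine ⟨?_, fun u hu1 hu2 => ?_⟩
      · simp [State.writeNat_nat, hy, hmod]
      · simp only [State.writeNat_nat, NExpr.eval, hidx]
        rcases hu1.eq_or_lt with h | h
        · subst h; simp [hbit]
        · simp [h.ne', hb u h hu2]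
  · rintro s' ⟨-, hb⟩ - u hu
    exact hb u (by omega) hu
  · simp [NExpr.ops]; omega

/-- One more than the position of the period before `t` in the pattern. -/
def nextPos (T w : ℕ) : ℕ → ℕ
  | 0 => w
  | t + 1 => patternPos T w t + 1

/-- Division-free update of the position. At the end of a window it returns to `0` if another
complete window fits, and otherwise runs on into the second block. The initial value `w` treats
period `0` like the end of a window. -/
lemma patternPos_eq {T w t : ℕ} (hw : 0 < w) (ht : t < T) :
    patternPos T w t = if nextPos T w t = w ∧ t + w ≤ T then 0 else nextPos T w t := by
  obtain ⟨k, hk⟩ : ∃ k, k = T / w := ⟨_, rfl⟩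
  have hkT : k * w ≤ T := hk ▸ Nat.div_mul_le_self T w
  have hTk : T < k * w + w := by
    have := Nat.lt_div_mul_add (a := T) hw
    rwa [← hk] at this
  cases t with
  | zero =>
    simp only [patternPos, nextPos, ← hk, true_and, zero_add]
    rcases Nat.eq_zero_or_pos k with h | h
    · subst h; simp; omega
    · have := Nat.mul_le_mul_right w h
      rw [if_pos (by omega), if_pos (by omega), Nat.zero_mod]
  | succ t =>
    simp only [nextPos, patternPos, ← hk]
    have h1 := Nat.div_add_mod t w
    have h2 := Nat.mod_lt t hw
    rw [mul_comm] at h1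
    set a := t / w
    set b := t % w
    have hmod : (t + 1) % w = if b + 1 = w then 0 else b + 1 := by
      rw [← h1, show a * w + b + 1 = b + 1 + a * w by ring, Nat.add_mul_mod_self_right]
      split_ifs with h
      · rw [h, Nat.mod_self]
      · exact Nat.mod_eq_of_lt (by omega)
    rw [hmod]
    have hk1 : ∀ c, c < k → c * w + w ≤ k * w := fun c hc => by
      have := Nat.mul_le_mul_right w (show c + 1 ≤ k from hc)
      rwa [add_mul, one_mul] at this
    by_cases hlt : t < k * w
    · rw [if_pos hlt]
      have hak : a < k := by
        by_contra h
        have := Nat.mul_le_mul_right w (not_lt.1 h); omega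
      have := hk1 a hak
      by_cases hb : b + 1 = w
      · simp only [hb, if_true, true_and]
        rcases Nat.lt_or_ge (a + 1) k with h | h
        · have := hk1 (a + 1) h
          rw [add_mul, one_mul] at this
          rw [if_pos (by omega), if_pos (by omega)]
        · have hka : k = a + 1 := by omega
          have : k * w = a * w + w := by rw [hka]; ring
          rw [if_neg (by omega), if_neg (by omega)]; omega
      · simp only [hb, if_false, false_and]
        rw [if_pos (by omega)]
    · rw [if_neg hlt, if_neg (by omega), if_neg (by omega)]; omega

lemma patternPos_lt {T w t : ℕ} (hw : 0 < w) (ht : t < T) : patternPos T w t < w + w := by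
  have := Nat.lt_div_mul_add (a := T) hw
  rw [patternPos]
  split_ifs
  · have := Nat.mod_lt t hw; omega
  · omega

/-- Tests whether a complete window starts at period `nvar 13`. -/
def windowTest : BExpr :=
  .and (.and (.natLe (nvar 11) (nvar 3)) (.natLe (nvar 3) (nvar 11)))
    (.and (.natLe (nvar 12) (.lit 0))
      (.realLe (.add (.ofNat (nvar 13)) (.mul (.ofNat (nvar 3)) (.ofNat (nvar 5))))
        (.ofNat (.get 0 (.lit 1)))))

def restartStep : Prog := .ite windowTest (.setNat 11 (.lit 0) (.lit 0)) .skip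

def memberStep : Prog :=
  .ite (.natLe (nvar 13) (.lit 0)) (.setNat 10 (nvar 13) (.lit 1))
    (.ite (.natLe (nvar 12) (.lit 0)) (.setNat 10 (nvar 13) (.get 7 (nvar 11)))
      (.setNat 10 (nvar 13) (.lit 0)))

def countStep : Prog :=
  .ite (.natLe (.get 10 (nvar 13)) (.lit 0)) .skip
    (.setReal 5 (.lit 0) (.add (.get 5 (.lit 0)) (.get 0 (.lit 1))))

def advanceStep : Prog :=
  .seq (.setNat 12 (.lit 0) (.add (nvar 12) (.lit 1)))
    (.ite (.natLe (nvar 5) (nvar 12))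
      (.seq (.setNat 12 (.lit 0) (.lit 0)) (.setNat 11 (.lit 0) (.add (nvar 11) (.lit 1)))) .skip)

/-- Stores in array `10` which periods belong to the candidate, and its joint ordering cost in the
real array `5`. -/
def buildSet : Prog :=
  .seq (.setNat 11 (.lit 0) (nvar 3)) (.seq (.setNat 12 (.lit 0) (.lit 0))
    (.seq (.setReal 5 (.lit 0) (.ofNat (.lit 0)))
      (.forLoop 13 (.get 0 (.lit 1))
        (.seq restartStep (.seq memberStep (.seq countStep advanceStep))))))

/-- The position is stored as a bit index and an offset below `d`, which avoids division of
naturals. Whether a window of length `W * d` still fits is tested over the reals, where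
multiplication is available. -/
lemma runs_restartStep {s : State} {T W d t : ℕ} (hT : s.nat 0 1 = T) (hW : s.nat 3 0 = W)
    (hd : s.nat 5 0 = d) (ht : s.nat 13 0 = t) (hv : s.nat 12 0 < d) (hWpos : 0 < W) (htT : t < T)
    (hpos : s.nat 11 0 * d + s.nat 12 0 = nextPos T (W * d) t) :
    Runs restartStep s 50 (fun s' => s'.nat 11 0 * d + s.nat 12 0 = patternPos T (W * d) t) := by
  have hw : 0 < W * d := Nat.mul_pos hWpos (by omega)
  have hiff : windowTest.Holds s ↔ nextPos T (W * d) t = W * d ∧ t + W * d ≤ T := by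
    simp only [windowTest, BExpr.Holds, NExpr.eval, RExpr.eval, hT, hW, hd, ht, ← hpos]
    have e : ((t : ℝ) + (W : ℝ) * d ≤ T) ↔ t + W * d ≤ T := by
      rw [← Nat.cast_mul, ← Nat.cast_add, Nat.cast_le]
    rw [e]
    constructor
    · rintro ⟨⟨h1, h2⟩, h3, h4⟩
      rw [le_antisymm h1 h2, Nat.le_zero.1 h3]; exact ⟨rfl, h4⟩
    · rintro ⟨h1, h2⟩
      have h3 : s.nat 12 0 = 0 := by
        have := congrArg (· % d) h1
        simpa [Nat.mod_eq_of_lt hv] using this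
      rw [h3, add_zero] at h1
      have := Nat.eq_of_mul_eq_mul_right (by omega) h1
      omega
  refine Runs.bound (Runs.ite (fun hc => Runs.setNat ?_) (fun hc => Runs.skip ?_)) (by decide)
  · rw [patternPos_eq hw htT, if_pos (hiff.1 hc)]
    have h := (hiff.1 hc)
    simp only [windowTest, BExpr.Holds, NExpr.eval] at hc
    simp [State.writeNat_nat, NExpr.eval]
    omega
  · rw [patternPos_eq hw htT, if_neg (fun h => hc (hiff.2 h)), hpos]

lemma runs_memberStep {s : State} {T W d x t : ℕ} (ht : s.nat 13 0 = t) (hv : s.nat 12 0 < d)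
    (hWpos : 0 < W) (htT : t < T)
    (hbits : ∀ u < W + W, s.nat 7 u = (x.testBit u).toNat)
    (hpos : s.nat 11 0 * d + s.nat 12 0 = patternPos T (W * d) t) :
    Runs memberStep s 50 (fun s' => (s'.nat 10 t ≠ 0 ↔ t ∈ candidate T W d x) ∧
      ∀ r < t, s'.nat 10 r = s.nat 10 r) := by
  have hdpos : 0 < d := by omega
  have hlt := patternPos_lt (Nat.mul_pos hWpos hdpos) htT
  have hu : s.nat 11 0 < W + W := by
    have : s.nat 11 0 * d < (W + W) * d := by rw [add_mul]; omega
    exact lt_of_mul_lt_mul_right this (Nat.zero_le _)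
  -- Only offset `0` is a unit boundary, where an order is possible; there the stored index is the
  -- bit to read.
  have hdvd : d ∣ patternPos T (W * d) t ↔ s.nat 12 0 = 0 := by
    rw [← hpos, Nat.dvd_add_right (Dvd.intro_left _ rfl)]
    exact ⟨fun h => Nat.eq_zero_of_dvd_of_lt h hv, fun h => by rw [h]; exact dvd_zero d⟩
  have hdiv : patternPos T (W * d) t / d = s.nat 11 0 := by
    rw [← hpos, mul_comm, Nat.mul_add_div hdpos, Nat.div_eq_of_lt hv, add_zero]
  have hmem : t ∈ candidate T W d x ↔ t = 0 ∨ (s.nat 12 0 = 0 ∧ x.testBit (s.nat 11 0) = true) := by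
    simp [candidate, htT, hdvd, hdiv]
  rw [hmem]
  refine Runs.bound (Runs.ite (fun hc => Runs.setNat ?_) (fun hc => Runs.ite
    (fun hc' => Runs.setNat ?_) (fun hc' => Runs.setNat ?_))) (by decide)
  all_goals simp only [BExpr.Holds, NExpr.eval, ht] at hc
  · simp [State.writeNat_nat, NExpr.eval, ht]
    refine ⟨Or.inl (by omega), fun r hr => ?_⟩
    rw [Function.update_of_ne (by omega)]
  · simp only [BExpr.Holds, NExpr.eval] at hc'
    simp [State.writeNat_nat, NExpr.eval, ht, hbits _ hu]
    refine ⟨?_, fun r hr => by rw [Function.update_of_ne (by omega)]⟩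
    rw [show s.nat 12 0 = 0 by omega]
    simp [show t ≠ 0 by omega]
  · simp only [BExpr.Holds, NExpr.eval] at hc'
    simp [State.writeNat_nat, NExpr.eval, ht]
    refine ⟨⟨by omega, fun h => by omega⟩, fun r hr => by rw [Function.update_of_ne (by omega)]⟩

lemma runs_advanceStep {s : State} {d : ℕ} (hd : s.nat 5 0 = d) (hv : s.nat 12 0 < d) :
    Runs advanceStep s 50 (fun s' => s'.nat 12 0 < d ∧
      s'.nat 11 0 * d + s'.nat 12 0 = s.nat 11 0 * d + s.nat 12 0 + 1) := by
  refine Runs.bound (Runs.seq (Runs.setNat (Runs.ite (fun hc => Runs.seq (Runs.setNat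
    (Runs.setNat ?_))) (fun hc => Runs.skip ?_)))) (by decide)
  all_goals
    simp [BExpr.Holds, NExpr.eval, State.writeNat_nat, hd] at hc
    simp [NExpr.eval, State.writeNat_nat]
  · rw [add_mul]; omega
  · omega

lemma runs_buildSet {s : State} {T W d x : ℕ} (hT : s.nat 0 1 = T) (hW : s.nat 3 0 = W)
    (hd : s.nat 5 0 = d) (hdpos : 0 < d) (hWpos : 0 < W)
    (hbits : ∀ u < W + W, s.nat 7 u = (x.testBit u).toNat) :
    Runs buildSet s (T * 300 + 100) (fun s' =>
      (∀ t < T, s'.nat 10 t ≠ 0 ↔ t ∈ candidate T W d x) ∧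
      s'.real 5 0 = s.real 0 1 * (candidate T W d x).card) := by
  refine Runs.bound (Runs.seq (Runs.setNat (Runs.seq (Runs.setNat (Runs.seq (Runs.setReal
    (Runs.forLoop T (fun t s' => s'.nat 12 0 < d ∧
        s'.nat 11 0 * d + s'.nat 12 0 = nextPos T (W * d) t ∧
        (∀ r < t, s'.nat 10 r ≠ 0 ↔ r ∈ candidate T W d x) ∧
        s'.real 5 0 = s.real 0 1 * ((candidate T W d x).filter (· < t)).card)
      (B := 250) (by decide) ?_ (fun j s' y h => h) ?_ ?_ ?_))))))) ?_
  · intro s' ha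
    have := congrFun (ha.nat 0 (by decide)) 1
    simp [State.writeNat_nat, NExpr.eval] at this ⊢
    omega
  · simp [State.writeNat_nat, State.writeReal_real, NExpr.eval, RExpr.eval, hW, nextPos, hdpos]
  · rintro t htT s₀ ⟨hv, hpos, hmem, hreal⟩ htv ha
    have h0 := congrFun (ha.nat 0 (by decide)) 1
    have h3 := congrFun (ha.nat 3 (by decide)) 0
    have h5 := congrFun (ha.nat 5 (by decide)) 0
    have h7 := ha.nat 7 (by decide)
    have hr0 := congrFun (ha.real 0 (by decide)) 1
    simp [State.writeNat_nat, State.writeReal_real, hT, hW, hd] at h0 h3 h5 h7 hr0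
    refine Runs.bound (C := 250) (Runs.seq (Runs.mono
      (runs_restartStep h0 h3 h5 htv hv hWpos htT hpos) le_rfl ?_)) (by decide : 50 + 200 ≤ 250)
    intro s₁ a₁ hpos₁
    have e12 := congrFun (a₁.nat 12 (by decide)) 0
    rw [← e12] at hpos₁ hv
    refine Runs.bound (C := 200) (Runs.seq (Runs.mono (runs_memberStep (s := s₁) (T := T) (W := W)
      (d := d) (x := x) (t := t) ?_ hv hWpos htT ?_ hpos₁) le_rfl ?_)) (by decide : 50 + 150 ≤ 200)
    · rw [a₁.nat 13 (by decide), htv]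
    · intro u hu; rw [a₁.nat 7 (by decide), h7]; exact hbits u hu
    rintro s₂ a₂ ⟨hm2, hm2'⟩
    have hfil := filter_lt_succ (candidate T W d x) t
    have hstep : Runs countStep s₂ 50 (fun s' => s'.real 5 0 =
        s.real 0 1 * ((candidate T W d x).filter (· < t + 1)).card) := by
      have ht2 : s₂.nat 13 0 = t := by rw [a₂.nat 13 (by decide), a₁.nat 13 (by decide), htv]
      have hr2 : s₂.real 5 0 = s.real 0 1 * ((candidate T W d x).filter (· < t)).card := by
        rw [a₂.real 5 (by decide), a₁.real 5 (by decide), hreal]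
      have hr02 : s₂.real 0 1 = s.real 0 1 := by
        rw [a₂.real 0 (by decide), a₁.real 0 (by decide), hr0]
      rw [hfil]
      refine Runs.bound (Runs.ite (fun hc => Runs.skip ?_) (fun hc => Runs.setReal ?_)) (by decide)
      all_goals simp only [BExpr.Holds, NExpr.eval, ht2] at hc
      · rw [if_neg (fun h => (hm2.2 h) (by omega)), hr2]
      · rw [if_pos (hm2.1 (by omega)), Finset.card_insert_of_notMem (by simp)]
        simp [State.writeReal_real, NExpr.eval, RExpr.eval, hr2, hr02]; ring
    refine Runs.bound (C := 150) (Runs.seq (Runs.mono hstep le_rfl ?_))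
      (by decide : 50 + 50 ≤ 150)
    intro s₃ a₃ hr3
    have e5 : s₃.nat 5 0 = d := by
      rw [a₃.nat 5 (by decide), a₂.nat 5 (by decide), a₁.nat 5 (by decide), h5]
    have e12' : s₃.nat 12 0 = s₁.nat 12 0 := by rw [a₃.nat 12 (by decide), a₂.nat 12 (by decide)]
    have e11' : s₃.nat 11 0 = s₁.nat 11 0 := by rw [a₃.nat 11 (by decide), a₂.nat 11 (by decide)]
    refine Runs.mono (runs_advanceStep e5 (by rw [e12']; exact hv)) le_rfl ?_
    rintro s₄ a₄ ⟨hv4, hp4⟩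
    refine ⟨hv4, ?_, ?_, ?_⟩
    · rw [hp4, e12', e11', hpos₁]; rfl
    · intro r hr
      rw [a₄.nat 10 (by decide), a₃.nat 10 (by decide)]
      rcases Nat.lt_succ_iff_lt_or_eq.1 hr with h | h
      · rw [hm2' r h, a₁.nat 10 (by decide)]; exact hmem r h
      · subst h; exact hm2
    · rw [a₄.real 5 (by decide)]; exact hr3
  · rintro s' ⟨-, -, hmem, hreal⟩ -
    refine ⟨hmem, ?_⟩
    rw [hreal, Finset.filter_true_of_mem
      fun r hr => Finset.mem_range.1 (candidate_subset T W d x hr)]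
  · simp [NExpr.ops, RExpr.ops]; omega

/-! ## Evaluating a candidate -/

/-- Optimality at `t` depends only on `V` from `t` on and on `nx t`, so the backward recursion
cannot destroy it later. -/
lemma OptimalAt.congr {K H : ℝ} {T : ℕ} {S : Finset ℕ} {V V' : ℕ → ℝ} {nx nx' : ℕ → ℕ} {t : ℕ}
    (h : OptimalAt K H T S V nx t) (hV : ∀ r, t ≤ r → V' r = V r) (hnx : nx' t = nx t) :
    OptimalAt K H T S V' nx' t where
  lt := hnx ▸ h.lt
  le := hnx ▸ h.le
  mem := hnx ▸ h.mem
  eq := by rw [hnx, hV t le_rfl, hV _ h.lt.le]; exact h.eq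
  min r hr hr' := by rw [hV t le_rfl, hV r hr.le]; exact h.min r hr hr'

/-- The cost from period `nvar 16` on, if item `nvar 14` is ordered there and then at `e`. -/
def gapCost (e : NExpr) : RExpr :=
  .add (.add (.get 1 (nvar 14)) (.mul (.get 2 (nvar 14))
    (.mul (.sub (.ofNat e) (.ofNat (nvar 16))) (.sub (.ofNat e) (.ofNat (nvar 16)))))) (.get 4 e)

def improveStep : Prog :=
  .ite (.and (.natLe (.add (nvar 16) (.lit 1)) (nvar 17))
      (.and (.natLe (.lit 1) (.get 10 (nvar 17)))
        (.not (.realLe (.get 4 (nvar 16)) (gapCost (nvar 17))))))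
    (.seq (.setReal 4 (nvar 16) (gapCost (nvar 17))) (.setNat 18 (nvar 16) (nvar 17))) .skip

/-- The periods are treated backwards. The end of the horizon is an admissible successor and
initialises the minimum, which is then improved over all later periods in the candidate. -/
def optimizeStep : Prog :=
  .seq (.setNat 16 (.lit 0) (.sub (.get 0 (.lit 1)) (.add (nvar 15) (.lit 1))))
    (.seq (.setReal 4 (nvar 16) (gapCost (.get 0 (.lit 1))))
      (.seq (.setNat 18 (nvar 16) (.get 0 (.lit 1)))
        (.forLoop 17 (.get 0 (.lit 1)) improveStep)))

/-- Computes optimal costs (real array `4`) and successors (array `18`) for item `nvar 14`. -/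
def optimizeItem : Prog :=
  .seq (.setReal 4 (.get 0 (.lit 1)) (.ofNat (.lit 0))) (.forLoop 15 (.get 0 (.lit 1)) optimizeStep)

lemma eval_gapCost (s : State) (e : NExpr) : (gapCost e).eval s =
    s.real 1 (s.nat 14 0) + s.real 2 (s.nat 14 0) * ((e.eval s : ℝ) - s.nat 16 0) ^ 2
      + s.real 4 (e.eval s) := by
  simp only [gapCost, RExpr.eval, NExpr.eval]; ring

lemma runs_optimizeStep {s : State} {T i j t : ℕ} {S : Finset ℕ} (hT : s.nat 0 1 = T)
    (hi : s.nat 14 0 = i) (hj : s.nat 15 0 = j) (ht : T = t + (j + 1))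
    (hS : ∀ r < T, s.nat 10 r ≠ 0 ↔ r ∈ S) (hST : S ⊆ Finset.range T) :
    Runs optimizeStep s (T * 150 + 150) (fun s' =>
      OptimalAt (s.real 1 i) (s.real 2 i) T S (s'.real 4) (s'.nat 18) t ∧
      ∀ r, t < r → s'.real 4 r = s.real 4 r ∧ s'.nat 18 r = s.nat 18 r) := by
  set K := s.real 1 i with hK
  set H := s.real 2 i with hH
  refine Runs.bound (Runs.seq (Runs.setNat (Runs.seq (Runs.setReal (Runs.seq (Runs.setNat
    (Runs.forLoop T (fun r s' => (∀ q, t < q →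
          s'.real 4 q = s.real 4 q ∧ s'.nat 18 q = s.nat 18 q) ∧
        t < s'.nat 18 t ∧ s'.nat 18 t ≤ T ∧ (s'.nat 18 t = T ∨ s'.nat 18 t ∈ S) ∧
        s'.real 4 t = K + H * ((s'.nat 18 t : ℝ) - t) ^ 2 + s.real 4 (s'.nat 18 t) ∧
        s'.real 4 t ≤ K + H * ((T : ℝ) - t) ^ 2 + s.real 4 T ∧
        ∀ q < r, t < q → q ∈ S → s'.real 4 t ≤ K + H * ((q : ℝ) - t) ^ 2 + s.real 4 q)
      (B := 120) (by decide) ?_ (fun j s' y h => h) ?_ ?_ ?_))))))) ?_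
  · intro s' ha
    have := congrFun (ha.nat 0 (by decide)) 1
    simp [State.writeNat_nat, NExpr.eval] at this ⊢
    omega
  · have hsub : T - (j + 1) = t := by omega
    simp [State.writeNat_nat, State.writeReal_real, NExpr.eval, eval_gapCost, hT, hi, hj, hsub]
    refine ⟨fun q hq => ?_, ?_⟩
    · rw [Function.update_of_ne (by omega), Function.update_of_ne (by omega)]; simp
    · simp [← hK, ← hH]; omega
  · rintro r hr s' ⟨hsame, h1, h2, h3, h4, h5, h6⟩ hrv ha
    have e14 := congrFun (ha.nat 14 (by decide)) 0
    have e16 := congrFun (ha.nat 16 (by decide)) 0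
    have e10 := ha.nat 10 (by decide)
    have f1 := ha.real 1 (by decide)
    have f2 := ha.real 2 (by decide)
    have hsub : T - (j + 1) = t := by omega
    simp [State.writeNat_nat, State.writeReal_real, NExpr.eval, hT, hi, hj, hsub]
      at e14 e16 e10 f1 f2
    have hg : t < r → (gapCost (nvar 17)).eval s' = K + H * ((r : ℝ) - t) ^ 2 + s.real 4 r := by
      intro htr
      simp [eval_gapCost, NExpr.eval, e14, e16, f1, f2, hrv, (hsame r htr).1, hK, hH]
    refine Runs.bound (Runs.ite (fun hc => Runs.seq (Runs.setReal (Runs.setNat ?_)))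
      (fun hc => Runs.skip ?_)) (C := 120) (by decide)
    · simp only [BExpr.Holds, NExpr.eval, RExpr.eval, e16, hrv, e10] at hc
      obtain ⟨c1, c2, c3⟩ := hc
      have htr : t < r := by omega
      have hg := hg htr
      rw [hg] at c3
      have hrS : r ∈ S := (hS r hr).1 (by omega)
      simp only [State.writeNat_nat, State.writeReal_real, NExpr.eval, e16, hrv,
        State.writeReal_nat, State.writeNat_real, hg]
      simp only [if_true, Function.update_self]
      refine ⟨fun q hq => ?_, htr, hr.le, Or.inr hrS, trivial, by linarith, fun q hq htq hqS => ?_⟩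
      · rw [Function.update_of_ne (by omega), Function.update_of_ne (by omega)]; exact hsame q hq
      · rcases Nat.lt_succ_iff_lt_or_eq.1 hq with h | h
        · linarith [h6 q h htq hqS]
        · subst h; exact le_rfl
    · refine ⟨hsame, h1, h2, h3, h4, h5, fun q hq htq hqS => ?_⟩
      rcases Nat.lt_succ_iff_lt_or_eq.1 hq with h | h
      · exact h6 q h htq hqS
      · subst h
        by_contra hcon
        refine hc ?_
        simp only [BExpr.Holds, NExpr.eval, RExpr.eval, e16, hrv, e10]
        refine ⟨htq, Nat.one_le_iff_ne_zero.2 ((hS q hr).2 hqS), ?_⟩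
        rw [hg htq]; exact hcon
  · rintro s' ⟨hsame, h1, h2, h3, h4, h5, h6⟩ -
    refine ⟨⟨h1, h2, h3, ?_, ?_⟩, hsame⟩
    · rw [(hsame _ h1).1]; exact h4
    · rintro r htr (rfl | hrS)
      · rw [(hsame _ htr).1]; exact h5
      · rw [(hsame _ htr).1]; exact h6 r (Finset.mem_range.1 (hST hrS)) htr hrS
  · simp [NExpr.ops, RExpr.ops, gapCost]; omega

lemma runs_optimizeItem {s : State} {T i : ℕ} {S : Finset ℕ} (hT : s.nat 0 1 = T)
    (hi : s.nat 14 0 = i) (hS : ∀ r < T, s.nat 10 r ≠ 0 ↔ r ∈ S) (hST : S ⊆ Finset.range T) :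
    Runs optimizeItem s (T * (T * 150 + 200) + 50) (fun s' => s'.real 4 T = 0 ∧
      ∀ t < T, OptimalAt (s.real 1 i) (s.real 2 i) T S (s'.real 4) (s'.nat 18) t) := by
  refine Runs.bound (Runs.seq (Runs.setReal (Runs.forLoop T (fun j s' => s'.real 4 T = 0 ∧
        ∀ t < T, T ≤ t + j → OptimalAt (s.real 1 i) (s.real 2 i) T S (s'.real 4) (s'.nat 18) t)
      (B := T * 150 + 150) (by decide) ?_ (fun j s' y h => h) ?_ ?_ ?_))) ?_
  · intro s' ha
    have := congrFun (ha.nat 0 (by decide)) 1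
    simp [NExpr.eval] at this ⊢
    omega
  · simp only [State.writeReal_real, RExpr.eval, NExpr.eval, hT]
    refine ⟨by simp, fun t h1 h2 => by omega⟩
  · rintro j hj s₀ ⟨hV, hopt⟩ hjv ha
    have e0 := congrFun (ha.nat 0 (by decide)) 1
    have e14 := congrFun (ha.nat 14 (by decide)) 0
    have e10 := ha.nat 10 (by decide)
    have f1 := ha.real 1 (by decide)
    have f2 := ha.real 2 (by decide)
    simp [State.writeReal_real, hT, hi] at e0 e14 e10 f1 f2
    refine Runs.mono (runs_optimizeStep (t := T - (j + 1)) e0 e14 hjv (by omega)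
      (by rw [e10]; exact hS) hST) le_rfl ?_
    rintro s₁ - ⟨h1, h2⟩
    rw [f1, f2] at h1
    refine ⟨by rw [(h2 T (by omega)).1, hV], fun t htT htj => ?_⟩
    rcases Nat.eq_or_lt_of_le (show T - (j + 1) ≤ t by omega) with h | h
    · rw [← h]; exact h1
    · exact (hopt t htT (by omega)).congr (fun r hr => (h2 r (by omega)).1) (h2 t h).2
  · rintro s' ⟨hV, hopt⟩ -
    exact ⟨hV, fun t ht => hopt t ht (by omega)⟩
  · simp [NExpr.ops, RExpr.ops]; nlinarith

/-- The output cell of item `nvar 14` and period `nvar 19`. -/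
def outIndex : NExpr := .add (nvar 21) (nvar 19)

/-- Variable `20` holds the next point of the chain. Cells without an order are cleared explicitly,
because an earlier candidate may have left its output there. -/
def traceStep : Prog :=
  .ite (.natLe (nvar 20) (nvar 19))
    (.seq (.setNat 1 outIndex (.lit 1))
      (.seq (.setReal 3 outIndex (.ofNat (.sub (.get 18 (nvar 19)) (nvar 19))))
        (.setNat 20 (.lit 0) (.get 18 (nvar 19)))))
    (.seq (.setNat 1 outIndex (.lit 0)) (.setReal 3 outIndex (.ofNat (.lit 0))))

/-- Writes the orders on the chain of the successors in array `18` to the output. -/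
def traceOrders : Prog :=
  .seq (.setNat 20 (.lit 0) (.lit 0)) (.forLoop 19 (.get 0 (.lit 1)) traceStep)

/-- The output cells from `b` on hold the orders on the chain of `nx`. -/
def WritesChain (T b : ℕ) (nx : ℕ → ℕ) (s : State) : Prop :=
  ∀ t < T, s.nat 1 (b + t) = (if chain nx t ≤ t then 1 else 0) ∧
    s.real 3 (b + t) = if chain nx t ≤ t then ((nx t - t : ℕ) : ℝ) else 0

lemma runs_traceOrders {s : State} {T b : ℕ} (hT : s.nat 0 1 = T) (hb : s.nat 21 0 = b) :
    Runs traceOrders s (T * 100 + 50) (fun s' => WritesChain T b (s.nat 18) s' ∧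
      ∀ r < b, s'.nat 1 r = s.nat 1 r ∧ s'.real 3 r = s.real 3 r) := by
  refine Runs.bound (Runs.seq (Runs.setNat (Runs.forLoop T
      (fun t s' => s'.nat 20 0 = chain (s.nat 18) t ∧ WritesChain t b (s.nat 18) s' ∧
        ∀ r < b, s'.nat 1 r = s.nat 1 r ∧ s'.real 3 r = s.real 3 r)
      (B := 70) (by decide) ?_ (fun j s' y h => h) ?_ ?_ ?_))) ?_
  · intro s' ha
    have := congrFun (ha.nat 0 (by decide)) 1
    simp [State.writeNat_nat, NExpr.eval] at this ⊢
    omega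
  · refine ⟨by simp [State.writeNat_nat, NExpr.eval, chain], fun t ht => by omega, fun r _ => ?_⟩
    simp [State.writeNat_nat]
  · rintro t htT s' ⟨hc, hw, hold⟩ htv ha
    have e21 := congrFun (ha.nat 21 (by decide)) 0
    have e18 := ha.nat 18 (by decide)
    simp [State.writeNat_nat, hb] at e21 e18
    have hw' : ∀ q < t + 1, q ≠ t → s'.nat 1 (b + q) = (if chain (s.nat 18) q ≤ q then 1 else 0) ∧
        s'.real 3 (b + q) = if chain (s.nat 18) q ≤ q then ((s.nat 18 q - q : ℕ) : ℝ) else 0 :=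
      fun q hq hqt => hw q (by omega)
    refine Runs.bound (Runs.ite (fun h => Runs.seq (Runs.setNat (Runs.seq (Runs.setReal
      (Runs.setNat ?_))))) (fun h => Runs.seq (Runs.setNat (Runs.setReal ?_)))) (C := 70)
      (by decide)
    all_goals
      simp only [BExpr.Holds, NExpr.eval, hc, htv] at h
      simp [WritesChain, outIndex, State.writeNat_nat, State.writeReal_real, NExpr.eval,
        RExpr.eval, htv, e21, e18, chain, h, hc]
      refine ⟨fun q hq => ?_, fun r hr => ?_⟩
      · by_cases hqt : q = t
        · subst hqt; simp [h]
        · rw [Function.update_of_ne (by omega), Function.update_of_ne (by omega)]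
          exact hw' q (by omega) hqt
      · rw [Function.update_of_ne (by omega), Function.update_of_ne (by omega)]
        exact hold r hr
  · rintro s' ⟨-, hw, hold⟩ -
    exact ⟨hw, hold⟩
  · simp [NExpr.ops]; omega

/-- Cell `0` of real array `4` is the optimal cost of the item. The row offset grows by `T` per
item, so no product of naturals is needed. -/
def itemStep : Prog :=
  .seq optimizeItem (.seq traceOrders
    (.seq (.setReal 5 (.lit 0) (.add (.get 5 (.lit 0)) (.get 4 (.lit 0))))
      (.setNat 21 (.lit 0) (.add (nvar 21) (.get 0 (.lit 1))))))

/-- Optimizes all items, writes their orders to the output and adds up their costs. -/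
def allItems : Prog :=
  .seq (.setNat 21 (.lit 0) (.lit 0)) (.forLoop 14 (.get 0 (.lit 0)) itemStep)

/-- The output cells from `b` on hold optimal orders of an item. -/
def WritesOptimal (K H : ℝ) (T : ℕ) (S : Finset ℕ) (b : ℕ) (s : State) : Prop :=
  ∃ V nx, V T = 0 ∧ (∀ t < T, OptimalAt K H T S V nx t) ∧ WritesChain T b nx s

lemma runs_allItems {s : State} {n T : ℕ} {S : Finset ℕ} (hn : s.nat 0 0 = n) (hT : s.nat 0 1 = T)
    (hTpos : 0 < T) (hS : ∀ r < T, s.nat 10 r ≠ 0 ↔ r ∈ S) (hST : S ⊆ Finset.range T)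
    (hS0 : 0 ∈ S) :
    Runs allItems s (n * (T * (T * 150 + 300) + 200) + 50) (fun s' =>
      s'.real 5 0 = s.real 5 0 +
        ∑ i ∈ Finset.range n, sInf (itemCosts (s.real 1 i) (s.real 2 i) T S) ∧
      ∀ i < n, WritesOptimal (s.real 1 i) (s.real 2 i) T S (i * T) s') := by
  refine Runs.bound (Runs.seq (Runs.setNat (Runs.forLoop n
      (fun i s' => s'.nat 21 0 = i * T ∧ s'.real 5 0 = s.real 5 0 +
          ∑ i ∈ Finset.range i, sInf (itemCosts (s.real 1 i) (s.real 2 i) T S) ∧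
        ∀ q < i, WritesOptimal (s.real 1 q) (s.real 2 q) T S (q * T) s')
      (B := T * (T * 150 + 300) + 150) (by decide) ?_ (fun j s' y h => h) ?_ ?_ ?_))) ?_
  · intro s' ha
    have := congrFun (ha.nat 0 (by decide)) 0
    simp [State.writeNat_nat, NExpr.eval] at this ⊢
    omega
  · simp [State.writeNat_nat, NExpr.eval]
  · rintro i hin s₀ ⟨hb, hsum, hrows⟩ hiv ha
    have e0 := congrFun (ha.nat 0 (by decide)) 1
    have e10 := ha.nat 10 (by decide)
    have f1 := ha.real 1 (by decide)
    have f2 := ha.real 2 (by decide)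
    simp [State.writeNat_nat, hT] at e0 e10 f1 f2
    refine Runs.bound (Runs.seq (Runs.mono (runs_optimizeItem (S := S) e0 hiv
      (by rw [e10]; exact hS) hST) le_rfl ?_)) (C := T * (T * 150 + 300) + 150)
      (show T * (T * 150 + 200) + 50 + (T * 100 + 100) ≤ T * (T * 150 + 300) + 150 from
        le_of_eq (by ring))
    rintro s₁ a₁ ⟨hV, hopt⟩
    rw [f1, f2] at hopt
    have e0' : s₁.nat 0 1 = T := by rw [a₁.nat 0 (by decide), e0]
    have e21' : s₁.nat 21 0 = i * T := by rw [a₁.nat 21 (by decide), hb]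
    refine Runs.bound (Runs.seq (Runs.mono (runs_traceOrders e0' e21') le_rfl ?_))
      (C := T * 100 + 100) (show T * 100 + 50 + 50 ≤ _ by omega)
    rintro s₂ a₂ ⟨hw, hold⟩
    have e0'' : s₂.nat 0 1 = T := by rw [a₂.nat 0 (by decide), e0']
    have e21'' : s₂.nat 21 0 = i * T := by rw [a₂.nat 21 (by decide), e21']
    have g5 : s₂.real 5 0 = s₀.real 5 0 := by rw [a₂.real 5 (by decide), a₁.real 5 (by decide)]
    have g4 : s₂.real 4 0 = s₁.real 4 0 := by rw [a₂.real 4 (by decide)]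
    refine Runs.bound (Runs.seq (Runs.setReal (Runs.setNat ?_))) (by decide)
    refine ⟨?_, ?_, fun q hq => ?_⟩
    · simp [State.writeNat_nat, NExpr.eval, e0'', e21'']; ring
    · simp [State.writeReal_real, NExpr.eval, RExpr.eval, g4, g5, hsum]
      rw [Finset.sum_range_succ, sInf_itemCosts_eq hopt hTpos hV hST hS0]; ring
    · rcases Nat.lt_succ_iff_lt_or_eq.1 hq with h | h
      · obtain ⟨V, nx, hV', hopt', hw'⟩ := hrows q h
        refine ⟨V, nx, hV', hopt', fun t ht => ?_⟩
        -- Rows of earlier items end before the current row begins and are not overwritten.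
        have hlt : q * T + t < i * T := by
          have := Nat.mul_le_mul_right T (show q + 1 ≤ i from h)
          rw [add_mul] at this; omega
        have h1 := hold _ hlt
        rw [a₁.nat 1 (by decide), a₁.real 3 (by decide)] at h1
        have h2 := hw' t ht
        simp only [State.writeNat_nat, State.writeReal_real, State.writeReal_nat,
          State.writeNat_real]
        simpa [h1] using h2
      · subst h
        refine ⟨s₁.real 4, s₁.nat 18, hV, hopt, fun t ht => ?_⟩
        have h2 := hw t ht
        simp only [State.writeNat_nat, State.writeReal_real, State.writeReal_nat,
          State.writeNat_real]
        simpa using h2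
  · rintro s' ⟨-, hsum, hrows⟩ -
    exact ⟨hsum, hrows⟩
  · simp [NExpr.ops]; nlinarith

/-- Evaluates the candidate with unit `nvar 5` and bits `nvar 6`. -/
def evalCandidate : Prog := .seq decodeBits (.seq buildSet allItems)

/-- The input is still in the memory. -/
structure Loaded (ε : ℝ) (I : Inst) (s : State) : Prop where
  nat0 : s.nat 0 = (input ε I).nat 0
  real0 : s.real 0 = (input ε I).real 0
  real1 : s.real 1 = (input ε I).real 1
  real2 : s.real 2 = (input ε I).real 2

lemma Loaded.of_agree {ε : ℝ} {I : Inst} {p : Prog} {s s' : State} (h : Loaded ε I s)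
    (ha : Agree p s s') (hn : 0 ∉ p.natMods) (h0 : 0 ∉ p.realMods) (h1 : 1 ∉ p.realMods)
    (h2 : 2 ∉ p.realMods) : Loaded ε I s' :=
  ⟨(ha.nat 0 hn).trans h.nat0, (ha.real 0 h0).trans h.real0, (ha.real 1 h1).trans h.real1,
    (ha.real 2 h2).trans h.real2⟩

section Loaded

variable {ε : ℝ} {I : Inst} {s : State}

lemma Loaded.n (h : Loaded ε I s) : s.nat 0 0 = I.n := by simp [h.nat0, input]

lemma Loaded.T (h : Loaded ε I s) : s.nat 0 1 = I.T := by simp [h.nat0, input]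

lemma Loaded.eps (h : Loaded ε I s) : s.real 0 0 = ε := by simp [h.real0, input]

lemma Loaded.K₀ (h : Loaded ε I s) : s.real 0 1 = I.K₀ := by simp [h.real0, input]

lemma Loaded.K (h : Loaded ε I s) (i : Fin I.n) : s.real 1 i = I.K i := by simp [h.real1, input]

lemma Loaded.H (h : Loaded ε I s) (i : Fin I.n) : s.real 2 i = I.H i := by simp [h.real2, input]

end Loaded

/-- Only an inequality for the cost, since some joint orders paid for in `S` may be used by no item.
-/
lemma output_of_writesOptimal {I : Inst} {s : State} {S : Finset ℕ} (hST : S ⊆ Finset.range I.T)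
    (hS0 : 0 ∈ S) (h : ∀ i : Fin I.n, WritesOptimal (I.K i) (I.H i) I.T S (i * I.T) s) :
    I.Feasible (output I s) ∧ I.cost (output I s) ≤ I.jointValue S := by
  have key : ∀ i, (output I s i).Feasible ∧
      (output I s i).cost (I.K i) (I.H i) = sInf (itemCosts (I.K i) (I.H i) I.T S) ∧
      (output I s i).times ⊆ S := by
    intro i
    obtain ⟨V, nx, hV, hopt, hw⟩ := h i
    rw [sInf_itemCosts_eq hopt I.T_pos hV hST hS0]
    refine feasible_and_cost_of_chain hopt I.T_pos hV hS0 (fun t => ?_) (fun t => ?_)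
    · simp [output, (hw t t.2).1]
    · exact (hw t t.2).2
  refine ⟨fun i => (key i).1, ?_⟩
  rw [Inst.cost, Inst.jointValue, ← Inst.card_jointTimes]
  refine add_le_add (mul_le_mul_of_nonneg_left ?_ I.K₀_nonneg)
    (Finset.sum_le_sum fun i _ => (key i).2.1.le)
  have : I.jointTimes (output I s) ⊆ S := fun t ht => by
    obtain ⟨i, hi⟩ := Inst.mem_jointTimes.1 ht
    exact (key i).2.2 hi
  exact_mod_cast Finset.card_le_card this

/-- The memory holds the number of bits and the powers of two. -/
structure Prepared (ε : ℝ) (I : Inst) (W : ℕ) (s : State) : Prop where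
  loaded : Loaded ε I s
  width : s.nat 3 0 = W
  pow : ∀ j ≤ W + W, s.nat 4 j = 2 ^ j

/-- A bound for the time to evaluate a candidate. -/
def evalTime (I : Inst) (W : ℕ) : ℕ :=
  (W + W) * 100 + I.T * 300 + I.n * (I.T * (I.T * 150 + 300) + 200) + 250

lemma runs_evalCandidate {ε : ℝ} {I : Inst} {W d x : ℕ} {s : State} (h : Prepared ε I W s)
    (hW : 0 < W) (hd : s.nat 5 0 = d) (hdpos : 0 < d) (hx : s.nat 6 0 = x)
    (hlt : x < 2 ^ (W + W)) :
    Runs evalCandidate s (evalTime I W) (fun s' =>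
      s'.real 5 0 = I.jointValue (candidate I.T W d x) ∧ I.Feasible (output I s') ∧
      I.cost (output I s') ≤ I.jointValue (candidate I.T W d x)) := by
  refine Runs.bound (Runs.seq (Runs.mono (runs_decodeBits h.width h.pow hx hlt) le_rfl ?_))
    (show (W + W) * 100 + 100 +
      (I.T * 300 + 100 + (I.n * (I.T * (I.T * 150 + 300) + 200) + 50)) ≤ _ by
        unfold evalTime; omega)
  intro s₁ a₁ hbits
  have l₁ := h.loaded.of_agree a₁ (by decide) (by decide) (by decide) (by decide)
  refine Runs.seq (Runs.mono (runs_buildSet (W := W) (d := d) l₁.T ?_ ?_ hdpos hW hbits) le_rfl ?_)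
  · rw [a₁.nat 3 (by decide), h.width]
  · rw [a₁.nat 5 (by decide), hd]
  rintro s₂ a₂ ⟨hmem, hreal⟩
  have l₂ := l₁.of_agree a₂ (by decide) (by decide) (by decide) (by decide)
  have hS0 := zero_mem_candidate I.T_pos W d x
  refine Runs.mono (runs_allItems l₂.n l₂.T I.T_pos hmem (candidate_subset _ _ _ _) hS0) le_rfl ?_
  rintro s₃ - ⟨hsum, hrows⟩
  refine ⟨?_, output_of_writesOptimal (candidate_subset _ _ _ _) hS0 fun i => ?_⟩
  · rw [hsum, hreal, l₁.K₀, Inst.jointValue, Finset.sum_range]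
    simp only [l₂.K, l₂.H]
  · have := hrows i i.2
    rwa [l₂.K, l₂.H] at this

/-! ## The algorithm -/

/-- The number of rounding units in a unit of the grid of joint orders. -/
def grain (ε : ℝ) : ℕ := max 8 ⌈8 / ε ^ 2⌉₊

lemma le_grain_mul {ε : ℝ} (hε : 0 < ε) : 8 ≤ (grain ε : ℝ) * ε ^ 2 := by
  have h1 : 8 / ε ^ 2 ≤ (grain ε : ℝ) :=
    (Nat.le_ceil _).trans (by exact_mod_cast le_max_right _ _)
  rwa [div_le_iff₀ (by positivity)] at h1

lemma eight_le_grain (ε : ℝ) : 8 ≤ grain ε := le_max_left _ _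

lemma mul_lt_of_lt_grain {ε : ℝ} (hε : 0 < ε) {j : ℕ} (h : 8 ≤ j) (h' : j < grain ε) :
    (j : ℝ) * ε ^ 2 < 8 := by
  rw [grain, lt_max_iff] at h'
  have h2 := Nat.lt_ceil.1 (h'.resolve_left (by omega))
  rwa [lt_div_iff₀ (by positivity)] at h2

lemma grain_le {ε : ℝ} (hε : 0 < ε) : (grain ε : ℝ) ≤ 9 + 8 / ε ^ 2 := by
  have h : 0 ≤ 8 / ε ^ 2 := by positivity
  have := Nat.ceil_lt_add_one h
  rw [grain, Nat.cast_max, max_le_iff]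
  constructor
  · push_cast; linarith
  · linarith

/-- Computes `grain ε`. -/
def computeGrain : Prog :=
  .seq (.setNat 2 (.lit 0) (.lit 8))
    (.loop (.not (.realLe (.ofNat (.lit 8))
        (.mul (.ofNat (nvar 2)) (.mul (.get 0 (.lit 0)) (.get 0 (.lit 0))))))
      (.setNat 2 (.lit 0) (.add (nvar 2) (.lit 1))))

/-- Rounding a real is not an operation of the machine; counting up from `8` until `8 ≤ g ε²`
replaces the ceiling. -/
lemma runs_computeGrain {ε : ℝ} (hε : 0 < ε) {s : State} (hs : s.real 0 0 = ε) :
    Runs computeGrain s (grain ε * 30 + 20) (fun s' => s'.nat 2 0 = grain ε) := by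
  have h8 := eight_le_grain ε
  refine Runs.bound (Runs.seq (Runs.setNat (Runs.loop (B := 7) (grain ε - 8)
    (fun j s' => s'.nat 2 0 = 8 + j) ?_ ?_ ?_))) ?_
  · simp [State.writeNat_nat, NExpr.eval]
  · intro j hj s' hI ha
    have hr := congrFun (ha.real 0 (by decide)) 0
    simp [hs] at hr
    have := mul_lt_of_lt_grain hε (show 8 ≤ 8 + j by omega) (by omega)
    refine ⟨?_, (Runs.setNat ?_).bound (by decide)⟩
    · simp only [BExpr.Holds, RExpr.eval, NExpr.eval, hI, hr, not_le, ← pow_two]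
      exact_mod_cast this
    · simp [State.writeNat_nat, NExpr.eval, hI]; ring
  · intro s' hI ha
    have hr := congrFun (ha.real 0 (by decide)) 0
    simp [hs] at hr
    rw [show 8 + (grain ε - 8) = grain ε by omega] at hI
    refine ⟨?_, hI⟩
    simp only [BExpr.Holds, RExpr.eval, NExpr.eval, hI, hr, not_not, ← pow_two]
    exact_mod_cast le_grain_mul hε
  · simp [NExpr.ops, RExpr.ops, BExpr.ops]; omega

/-- Stores the square of `nvar 2` in `nvar 3`. -/
def computeWidth : Prog :=
  .seq (.setNat 3 (.lit 0) (.lit 0))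
    (.loop (.not (.realLe (.mul (.ofNat (nvar 2)) (.ofNat (nvar 2))) (.ofNat (nvar 3))))
      (.setNat 3 (.lit 0) (.add (nvar 3) (.lit 1))))

lemma runs_computeWidth {s : State} {g : ℕ} (hs : s.nat 2 0 = g) :
    Runs computeWidth s (g * g * 30 + 20) (fun s' => s'.nat 3 0 = g * g) := by
  refine Runs.bound (Runs.seq (Runs.setNat (Runs.loop (B := 7) (g * g)
    (fun j s' => s'.nat 3 0 = j) ?_ ?_ ?_))) ?_
  · simp [State.writeNat_nat, NExpr.eval]
  · intro j hj s' hI ha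
    have hr := congrFun (ha.nat 2 (by decide)) 0
    simp [State.writeNat_nat, hs] at hr
    refine ⟨?_, (Runs.setNat ?_).bound (by decide)⟩
    · simp only [BExpr.Holds, RExpr.eval, NExpr.eval, hI, hr, not_le]
      exact_mod_cast hj
    · simp [State.writeNat_nat, NExpr.eval, hI]
  · intro s' hI ha
    have hr := congrFun (ha.nat 2 (by decide)) 0
    simp [State.writeNat_nat, hs] at hr
    refine ⟨?_, hI⟩
    simp only [BExpr.Holds, RExpr.eval, NExpr.eval, hI, hr, not_not]
    push_cast; exact le_rfl
  · simp [NExpr.ops, RExpr.ops, BExpr.ops]; omega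

/-- Stores powers of two in array `4`. -/
def computePowers : Prog :=
  .seq (.setNat 4 (.lit 0) (.lit 1))
    (.forLoop 9 (.add (nvar 3) (nvar 3))
      (.setNat 4 (.add (nvar 9) (.lit 1)) (.add (.get 4 (nvar 9)) (.get 4 (nvar 9)))))

lemma runs_computePowers {s : State} {W : ℕ} (hs : s.nat 3 0 = W) :
    Runs computePowers s ((W + W) * 40 + 30) (fun s' => ∀ j ≤ W + W, s'.nat 4 j = 2 ^ j) := by
  refine Runs.bound (Runs.seq (Runs.setNat (Runs.forLoop (W + W)
    (fun j s' => ∀ i ≤ j, s'.nat 4 i = 2 ^ i)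
    (B := 20) (by decide) ?_ (fun j s' y h => h) ?_ ?_ (fun s' h _ => h)))) ?_
  · intro s' ha
    have := congrFun (ha.nat 3 (by decide)) 0
    simp [State.writeNat_nat, NExpr.eval] at this ⊢
    omega
  · simp [State.writeNat_nat, NExpr.eval]
  · intro j hj s' hI hjv _
    refine (Runs.setNat ?_).bound (by decide)
    intro i hi
    simp only [State.writeNat_nat, NExpr.eval, hjv, if_true]
    rcases hi.eq_or_lt with h | h
    · subst h; rw [Function.update_self, hI j le_rfl, pow_succ]; ring
    · rw [Function.update_of_ne (by omega)]; exact hI i (by omega)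
  · simp [NExpr.ops]; omega

/-- Variable `26` flags that some candidate has been recorded; without it the initial content of
real array `6` would compete as a value. -/
def updateStep : Prog :=
  .ite (.and (.natLe (.lit 1) (nvar 26)) (.realLe (.get 6 (.lit 0)) (.get 5 (.lit 0)))) .skip
    (.seq (.setNat 26 (.lit 0) (.lit 1)) (.seq (.setReal 6 (.lit 0) (.get 5 (.lit 0)))
      (.seq (.setNat 22 (.lit 0) (nvar 5)) (.setNat 23 (.lit 0) (nvar 6)))))

def tryStep : Prog := .seq (.setNat 6 (.lit 0) (nvar 25)) (.seq evalCandidate updateStep)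

/-- Entry `2W` of the table of powers is the number of bit strings of length `2W`, hence the bound
of the loop. -/
def unitStep : Prog :=
  .seq (.setNat 5 (.lit 0) (.add (nvar 24) (.lit 1)))
    (.forLoop 25 (.get 4 (.add (nvar 3) (nvar 3))) tryStep)

/-- Stores the unit and the bits of the best candidate in `nvar 22` and `nvar 23`. -/
def search : Prog :=
  .seq (.setNat 26 (.lit 0) (.lit 0)) (.forLoop 24 (.add (.get 0 (.lit 1)) (.lit 1)) unitStep)

/-- The complete algorithm. -/
def solver : Prog :=
  .seq computeGrain (.seq computeWidth (.seq computePowers (.seq search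
    (.seq (.setNat 5 (.lit 0) (nvar 22)) (.seq (.setNat 6 (.lit 0) (nvar 23)) evalCandidate)))))

lemma Prepared.of_agree {ε : ℝ} {I : Inst} {W : ℕ} {p : Prog} {s s' : State}
    (h : Prepared ε I W s) (ha : Agree p s s') (hn : 0 ∉ p.natMods) (hn3 : 3 ∉ p.natMods)
    (hn4 : 4 ∉ p.natMods) (h0 : 0 ∉ p.realMods) (h1 : 1 ∉ p.realMods) (h2 : 2 ∉ p.realMods) :
    Prepared ε I W s' :=
  ⟨h.loaded.of_agree ha hn h0 h1 h2, by rw [ha.nat 3 hn3]; exact h.width,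
    by rw [ha.nat 4 hn4]; exact h.pow⟩

/-- The best candidate found so far is valid, and at least as good as those in `C`. -/
structure Best (I : Inst) (W : ℕ) (C : ℕ → ℕ → Prop) (s : State) : Prop where
  valid : 1 ≤ s.nat 26 0 → 0 < s.nat 22 0 ∧ s.nat 23 0 < 2 ^ (W + W) ∧
    s.real 6 0 = I.jointValue (candidate I.T W (s.nat 22 0) (s.nat 23 0))
  le : ∀ a x, C a x → 1 ≤ s.nat 26 0 ∧ s.real 6 0 ≤ I.jointValue (candidate I.T W (a + 1) x)

lemma Best.mono {I : Inst} {W : ℕ} {C D : ℕ → ℕ → Prop} {s : State} (h : Best I W C s)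
    (hDC : ∀ a x, D a x → C a x) : Best I W D s :=
  ⟨h.valid, fun a x hD => h.le a x (hDC a x hD)⟩

lemma Best.of_eq {I : Inst} {W : ℕ} {C : ℕ → ℕ → Prop} {s s' : State} (h : Best I W C s)
    (h22 : s'.nat 22 = s.nat 22) (h23 : s'.nat 23 = s.nat 23) (h26 : s'.nat 26 = s.nat 26)
    (h6 : s'.real 6 = s.real 6) : Best I W C s' :=
  ⟨by rw [h22, h23, h26, h6]; exact h.valid, by rw [h26, h6]; exact h.le⟩

lemma runs_tryStep {ε : ℝ} {I : Inst} {W a x : ℕ} {C : ℕ → ℕ → Prop} {s : State}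
    (h : Prepared ε I W s) (hW : 0 < W) (ha : s.nat 5 0 = a + 1) (hx : s.nat 25 0 = x)
    (hlt : x < 2 ^ (W + W)) (hbest : Best I W C s) :
    Runs tryStep s (evalTime I W + 60)
      (Best I W fun b y => C b y ∨ (b = a ∧ y = x)) := by
  have hp : Prepared ε I W (s.writeNat 6 0 x) := ⟨⟨h.loaded.nat0, h.loaded.real0, h.loaded.real1,
    h.loaded.real2⟩, h.width, h.pow⟩
  refine Runs.bound (Runs.seq (B := 4) (C := evalTime I W + 56) (Runs.setNat ?_)) (by omega)
  have e : (NExpr.lit 0).eval s = 0 := rfl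
  have e' : (nvar 25).eval s = x := hx
  rw [e, e']
  refine Runs.seq (Runs.mono (runs_evalCandidate hp hW (d := a + 1) ha (Nat.succ_pos a) (x := x)
    ?_ hlt) le_rfl ?_)
  · simp [State.writeNat_nat]
  rintro s₁ a₁ ⟨hval, -⟩
  have hb₁ : Best I W C s₁ := hbest.of_eq (a₁.nat 22 (by decide)) (a₁.nat 23 (by decide))
    (a₁.nat 26 (by decide)) (a₁.real 6 (by decide))
  have h5 : s₁.nat 5 0 = a + 1 := by rw [a₁.nat 5 (by decide)]; exact ha
  have h6 : s₁.nat 6 0 = x := by rw [a₁.nat 6 (by decide)]; simp [State.writeNat_nat]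
  refine Runs.bound (Runs.ite (fun hc => Runs.skip ?_) (fun hc => Runs.seq (Runs.setNat
    (Runs.seq (Runs.setReal (Runs.seq (Runs.setNat (Runs.setNat ?_)))))))) (by decide)
  · simp only [BExpr.Holds, NExpr.eval, RExpr.eval, hval] at hc
    refine ⟨hb₁.valid, ?_⟩
    rintro b y (hC | ⟨rfl, rfl⟩)
    · exact hb₁.le b y hC
    · exact hc
  · simp only [BExpr.Holds, NExpr.eval, RExpr.eval, hval, not_and, not_le] at hc
    refine ⟨fun _ => ?_, ?_⟩
    · simp [State.writeNat_nat, State.writeReal_real, NExpr.eval, RExpr.eval, hval, h5, h6, hlt]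
    · simp only [State.writeNat_nat, State.writeReal_real, NExpr.eval, RExpr.eval, hval,
        State.writeReal_nat, State.writeNat_real]
      rintro b y (hC | ⟨rfl, rfl⟩)
      · have := hb₁.le b y hC
        simpa using (hc this.1).le.trans this.2
      · simp

/-- A bound for the time of the search. -/
def searchTime (I : Inst) (W : ℕ) : ℕ :=
  (I.T + 1) * (2 ^ (W + W) * (evalTime I W + 100) + 100) + 100

lemma runs_search {ε : ℝ} {I : Inst} {W : ℕ} {s : State} (h : Prepared ε I W s) (hW : 0 < W) :
    Runs search s (searchTime I W)
      (Best I W fun a x => a < I.T + 1 ∧ x < 2 ^ (W + W)) := by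
  refine Runs.bound (Runs.seq (Runs.setNat (Runs.forLoop (I.T + 1)
    (fun a => Best I W fun b y => b < a ∧ y < 2 ^ (W + W))
    (B := 2 ^ (W + W) * (evalTime I W + 80) + 50) (by decide) ?_
    (fun j s' y h => h.of_eq rfl rfl rfl rfl) ?_ ?_ (fun s' h _ => h)))) ?_
  · intro s' ha
    have := congrFun (ha.nat 0 (by decide)) 1
    simp [State.writeNat_nat, NExpr.eval, h.loaded.T] at this ⊢
    omega
  · refine ⟨fun h => ?_, fun a x h => absurd h.1 (Nat.not_lt_zero a)⟩
    simp [State.writeNat_nat, NExpr.eval] at h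
  · intro a haT s₀ hbest hav ha
    have hp : Prepared ε I W s₀ := by
      have : Prepared ε I W (s.writeNat 26 0 0) := ⟨⟨h.loaded.nat0, h.loaded.real0, h.loaded.real1,
        h.loaded.real2⟩, h.width, h.pow⟩
      exact this.of_agree ha (by decide) (by decide) (by decide) (by decide) (by decide) (by decide)
    have hp₁ : Prepared ε I W (s₀.writeNat 5 0 (a + 1)) :=
      ⟨⟨hp.loaded.nat0, hp.loaded.real0, hp.loaded.real1, hp.loaded.real2⟩, hp.width, hp.pow⟩
    have e : (NExpr.lit 0).eval s₀ = 0 := rfl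
    have e' : (NExpr.add (nvar 24) (.lit 1)).eval s₀ = a + 1 := by simp [NExpr.eval, hav]
    refine Runs.bound (Runs.seq (Runs.setNat ?_)) (C := 2 ^ (W + W) * (evalTime I W + 80) + 50)
      (show (NExpr.lit 0).ops + (NExpr.add (nvar 24) (.lit 1)).ops + 1 +
        (2 ^ (W + W) * (6 + (evalTime I W + 60) + 12) + (6 + 12)) ≤ _ by
          simp only [NExpr.ops]; nlinarith [Nat.zero_le (2 ^ (W + W))])
    rw [e, e']
    -- Lexicographic progress: all bit strings for smaller units, and those below `x` for the
    -- current unit.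
    refine Runs.forLoop (2 ^ (W + W)) (fun x => Best I W fun b y =>
      (b < a ∧ y < 2 ^ (W + W)) ∨ (b = a ∧ y < x)) (by decide) ?_
      (fun j s' y h => h.of_eq rfl rfl rfl rfl) ?_ ?_ ?_
    · intro s' ha'
      have hp' := hp₁.of_agree ha' (by decide) (by decide) (by decide) (by decide) (by decide)
        (by decide)
      simp only [NExpr.eval, hp'.width]
      exact hp'.pow _ le_rfl
    · exact (hbest.of_eq rfl rfl rfl rfl : Best I W _ (s₀.writeNat 5 0 (a + 1))).mono
        fun b y hb => hb.resolve_right fun h => Nat.not_lt_zero _ h.2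
    · intro x hx s' hb hxv ha'
      have hp' := hp₁.of_agree ha' (by decide) (by decide) (by decide) (by decide) (by decide)
        (by decide)
      refine Runs.mono (runs_tryStep hp' hW (a := a) ?_ hxv hx hb) le_rfl fun s₂ _ h₂ =>
        h₂.mono fun b y hby => ?_
      · rw [ha'.nat 5 (by decide)]; simp [State.writeNat_nat]
      · rcases hby with h | ⟨h, h'⟩
        · exact Or.inl (Or.inl h)
        · rcases Nat.lt_succ_iff_lt_or_eq.1 h' with h' | h'
          · exact Or.inl (Or.inr ⟨h, h'⟩)
          · exact Or.inr ⟨h, h'⟩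
    · intro s' hb _
      refine hb.mono fun b y hby => ?_
      rcases Nat.lt_succ_iff_lt_or_eq.1 hby.1 with h' | h'
      · exact Or.inl ⟨h', hby.2⟩
      · exact Or.inr ⟨h', hby.2⟩
  · have h1 : 1 ≤ 2 ^ (W + W) := Nat.one_le_two_pow
    unfold searchTime
    simp only [NExpr.ops]
    have h2 : (I.T + 1) * (1 + 1 + 1 + 1 + (2 ^ (W + W) * (evalTime I W + 80) + 50) + 12) ≤
        (I.T + 1) * (2 ^ (W + W) * (evalTime I W + 100) + 100) := by
      refine Nat.mul_le_mul_left _ ?_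
      have : 2 ^ (W + W) * (evalTime I W + 80) ≤ 2 ^ (W + W) * (evalTime I W + 100) :=
        Nat.mul_le_mul_left _ (by omega)
      omega
    omega

theorem runs_solver {ε : ℝ} (hε : 0 < ε) (I : Inst) {W : ℕ} (hW : W = grain ε * grain ε) :
    Runs solver (input ε I) (W * 140 + searchTime I W + evalTime I W + 100) (fun s' =>
      I.Feasible (output I s') ∧ ∀ a ≤ I.T, ∀ x < 2 ^ (W + W),
        I.cost (output I s') ≤ I.jointValue (candidate I.T W (a + 1) x)) := by
  have h8 := eight_le_grain ε
  have hWpos : 0 < W := by rw [hW]; positivity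
  have hgW : grain ε ≤ W := by rw [hW]; exact Nat.le_mul_self _
  have l₀ : Loaded ε I (input ε I) := ⟨rfl, rfl, rfl, rfl⟩
  refine Runs.bound (Runs.seq (Runs.mono (runs_computeGrain hε l₀.eps) le_rfl ?_))
    (show grain ε * 30 + 20 + (W * 30 + 20 + ((W + W) * 40 + 30 + (searchTime I W +
      (4 + (4 + evalTime I W))))) ≤ _ by omega)
  intro s₁ a₁ hg
  have l₁ := l₀.of_agree a₁ (by decide) (by decide) (by decide) (by decide)
  have hwidth := runs_computeWidth hg
  rw [← hW] at hwidth
  refine Runs.seq (Runs.mono hwidth le_rfl ?_)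
  intro s₂ a₂ hw
  have l₂ := l₁.of_agree a₂ (by decide) (by decide) (by decide) (by decide)
  refine Runs.seq (Runs.mono (runs_computePowers hw) le_rfl ?_)
  intro s₃ a₃ hpow
  have p₃ : Prepared ε I W s₃ := ⟨l₂.of_agree a₃ (by decide) (by decide) (by decide) (by decide),
    by rw [a₃.nat 3 (by decide), hw], hpow⟩
  refine Runs.seq (Runs.mono (runs_search p₃ hWpos) le_rfl ?_)
  intro s₄ a₄ hbest
  have p₄ := p₃.of_agree a₄ (by decide) (by decide) (by decide) (by decide) (by decide) (by decide)
  -- The pair `(0, 0)` has been tried, so a best candidate is recorded.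
  have hflag := (hbest.le 0 0 ⟨Nat.succ_pos _, Nat.two_pow_pos _⟩).1
  obtain ⟨hd, hx, hval⟩ := hbest.valid hflag
  -- The output arrays hold the policy of the last candidate tried, so the winner is evaluated once
  -- more.
  refine Runs.seq (Runs.setNat (Runs.seq (Runs.setNat ?_)))
  refine Runs.mono (runs_evalCandidate (ε := ε) (d := s₄.nat 22 0) (x := s₄.nat 23 0)
    ⟨⟨p₄.loaded.nat0, p₄.loaded.real0, p₄.loaded.real1, p₄.loaded.real2⟩, p₄.width, p₄.pow⟩
    hWpos ?_ hd ?_ hx) le_rfl ?_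
  · simp [State.writeNat_nat, NExpr.eval]
  · simp [State.writeNat_nat, NExpr.eval]
  · rintro s₅ - ⟨-, hfeas, hcost⟩
    refine ⟨hfeas, fun a ha x hx' => hcost.trans ?_⟩
    rw [← hval]
    exact (hbest.le a x ⟨by omega, hx'⟩).2

/-! ## Running time -/

/-- Two factors `2 ^ W` count the bit strings and a third absorbs what is polynomial in `W`. An
evaluation takes `O(W + n T²)`, and there are `T + 1` units, whence the cube. -/
lemma solver_time_le (I : Inst) (W : ℕ) :
    W * 140 + searchTime I W + evalTime I W + 100 ≤ 10000 * 2 ^ (3 * W) * (I.n * I.T) ^ 3 := by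
  obtain ⟨X, hX⟩ : ∃ X, X = I.n * I.T := ⟨_, rfl⟩
  obtain ⟨Y, hY⟩ : ∃ Y, Y = 2 ^ W := ⟨_, rfl⟩
  have hn := I.n_pos
  have hT := I.T_pos
  have hX1 : 1 ≤ X := hX ▸ Nat.mul_pos hn hT
  have hTX : I.T ≤ X := hX ▸ Nat.le_mul_of_pos_left _ hn
  have hnX : I.n ≤ X := hX ▸ Nat.le_mul_of_pos_right _ hT
  have hWY : W ≤ Y := hY ▸ Nat.lt_two_pow_self.le
  have hY1 : 1 ≤ Y := hY ▸ Nat.one_le_two_pow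
  have hXX : X ≤ X ^ 2 := Nat.le_self_pow (by norm_num) X
  have hX2 : 1 ≤ X ^ 2 := Nat.one_le_pow _ _ hX1
  have hE : evalTime I W ≤ 1400 * (Y * X ^ 2) := by
    have h1 : I.n * (I.T * (I.T * 150 + 300) + 200) ≤ 650 * X ^ 2 := by
      have : I.n * (I.T * (I.T * 150 + 300) + 200) = X * I.T * 150 + X * 300 + I.n * 200 := by
        rw [hX]; ring
      rw [this]
      have : X * I.T ≤ X ^ 2 := by rw [pow_two]; exact Nat.mul_le_mul_left _ hTX
      omega
    have h2 : X ^ 2 ≤ Y * X ^ 2 := Nat.le_mul_of_pos_left _ hY1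
    have h3 : Y ≤ Y * X ^ 2 := Nat.le_mul_of_pos_right _ hX2
    unfold evalTime; omega
  have hYX : 1 ≤ Y * X ^ 2 := Nat.mul_pos hY1 hX2
  have hS : searchTime I W ≤ 3300 * (Y ^ 3 * X ^ 3) := by
    have e1 : 2 ^ (W + W) = Y ^ 2 := by rw [hY, ← pow_mul, ← two_mul, mul_comm]
    have h1 : 2 ^ (W + W) * (evalTime I W + 100) + 100 ≤ 1600 * (Y ^ 3 * X ^ 2) := by
      rw [e1]
      have h2 : Y ^ 2 * (evalTime I W + 100) ≤ Y ^ 2 * (1500 * (Y * X ^ 2)) :=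
        Nat.mul_le_mul_left _ (by omega)
      have h3 : Y ^ 2 * (1500 * (Y * X ^ 2)) = 1500 * (Y ^ 3 * X ^ 2) := by ring
      have h4 : 1 ≤ Y ^ 3 * X ^ 2 := Nat.mul_pos (Nat.one_le_pow _ _ hY1) hX2
      omega
    have h2 : (I.T + 1) * (2 ^ (W + W) * (evalTime I W + 100) + 100) ≤
        (2 * X) * (1600 * (Y ^ 3 * X ^ 2)) := Nat.mul_le_mul (by omega) h1
    have h3 : (2 * X) * (1600 * (Y ^ 3 * X ^ 2)) = 3200 * (Y ^ 3 * X ^ 3) := by ring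
    have h4 : 1 ≤ Y ^ 3 * X ^ 3 := Nat.mul_pos (Nat.one_le_pow _ _ hY1) (Nat.one_le_pow _ _ hX1)
    unfold searchTime; omega
  have hle : Y * X ^ 2 ≤ Y ^ 3 * X ^ 3 :=
    Nat.mul_le_mul (Nat.le_self_pow (by norm_num) Y) (Nat.pow_le_pow_right hX1 (by norm_num))
  have h3 : Y ≤ Y * X ^ 2 := Nat.le_mul_of_pos_right _ hX2
  have e3 : 2 ^ (3 * W) = Y ^ 3 := by rw [hY, ← pow_mul, mul_comm]
  rw [e3, ← hX, mul_assoc]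
  omega

lemma exists_two_pow_grain_le : ∃ A : ℕ, ∀ ε : ℝ, 0 < ε →
    (2 : ℝ) ^ (3 * (grain ε * grain ε)) ≤ A * (2 : ℝ) ^ ((384 : ℝ) * (1 / ε ^ 4)) := by
  -- With `y = 1 / ε²`, the exponent is at most `3 (9 + 8y)² ≤ 6 · 81 + 6 · 64 y² = 486 + 384 y²`.
  refine ⟨2 ^ 486, fun ε hε => ?_⟩
  rw [Nat.cast_pow, Nat.cast_ofNat, ← Real.rpow_natCast, ← Real.rpow_natCast 2 486,
    ← Real.rpow_add (by norm_num)]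
  refine Real.rpow_le_rpow_of_exponent_le (by norm_num) ?_
  push_cast
  have h := grain_le hε
  have e : 1 / ε ^ 4 = (1 / ε ^ 2) ^ 2 := by rw [div_pow, ← pow_mul, one_pow]
  have e' : 8 / ε ^ 2 = 8 * (1 / ε ^ 2) := by ring
  rw [e]
  rw [e'] at h
  have h0 : (0 : ℝ) ≤ grain ε := Nat.cast_nonneg _
  have := mul_self_le_mul_self h0 h
  nlinarith [sq_nonneg (9 - 8 * (1 / ε ^ 2))]

end JRP

end

/-! ### The main theorem -/

theorem theorem2 :
    ∃ (p : JRP.Prog) (A B c d : ℕ), ∀ (ε : ℝ), 0 < ε → ∀ (I : JRP.Inst),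
      ∃ (k : ℕ) (s : JRP.State),
        JRP.Exec p (JRP.input ε I) k s ∧
        (k : ℝ) ≤ (A : ℝ) *
          (2 : ℝ) ^ ((B : ℝ) * (1 / ε ^ 4) * (Real.log (2 + 1 / ε)) ^ c) *
          ((I.n : ℝ) * (I.T : ℝ)) ^ d ∧
        I.Feasible (JRP.output I s) ∧
        ∀ P : I.Policy, I.Feasible P →
          I.cost (JRP.output I s) ≤ (1 + ε) * I.cost P := by
  obtain ⟨A, hA⟩ := JRP.exists_two_pow_grain_le
  -- The exponent `c = 0` shows that no logarithmic factor is needed.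
  refine ⟨JRP.solver, 10000 * A, 384, 0, 3, fun ε hε I => ?_⟩
  have h8 := JRP.eight_le_grain ε
  obtain ⟨k, s, hexec, hk, hfeas, hopt⟩ := JRP.runs_solver hε I rfl
  refine ⟨k, s, hexec, ?_, hfeas, fun P hP => ?_⟩
  · have h1 := hk.trans (JRP.solver_time_le I _)
    have h2 : (k : ℝ) ≤ 10000 * 2 ^ (3 * (JRP.grain ε * JRP.grain ε)) * ((I.n : ℝ) * I.T) ^ 3 := by
      exact_mod_cast h1
    refine h2.trans ?_
    rw [pow_zero, mul_one]
    push_cast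
    rw [mul_assoc (10000 : ℝ) A]
    gcongr
    exact hA ε hε
  -- With `η = min ε 1 / 2` the loss `1 + 2η` is at most `1 + ε`. The condition `g η² ≥ 2` becomes
  -- `g ε² ≥ 8` for `ε ≤ 1` and `g ≥ 8` otherwise, which explains both terms of `grain`.
  · have hmin : 0 < min ε 1 := lt_min hε one_pos
    obtain ⟨e, he, x, hx, hle⟩ := JRP.exists_candidate_jointValue_le I hP
      (η := min ε 1 / 2) (by positivity) (by linarith [min_le_right ε 1]) (g := JRP.grain ε) (by
        rcases le_total ε 1 with h | h
        · rw [min_eq_left h]; linarith [JRP.le_grain_mul hε]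
        · rw [min_eq_right h]
          have : (8 : ℝ) ≤ JRP.grain ε := by exact_mod_cast h8
          linarith)
    refine (hopt e he x hx).trans (hle.trans ?_)
    have hcost : 0 ≤ I.cost P := by
      refine add_nonneg (mul_nonneg I.K₀_nonneg (Nat.cast_nonneg _))
        (Finset.sum_nonneg fun i _ => ?_)
      exact (JRP.setCost_nonneg (I.K_nonneg i) (I.H_nonneg i) _ _).trans
        ((hP i).setCost_le_cost (I.K i) (I.H_nonneg i))
    exact mul_le_mul_of_nonneg_right (by linarith [min_le_left ε 1]) hcost
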